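/- **Proposition.** Let $n\ge 4$, and let $\bar g_{ab}$ be a smooth Lorentzian metric of signature $(-,+,\dots,+)$ on an open coordinate domain $U\subseteq\mathbb R^n$ that is (locally) a de Sitter, Minkowski or anti-de Sitter metric, i.e. $\bar R_{abcd}=\frac{2\Lambda}{(n-1)(n-2)}(\bar g_{ac}\bar g_{bd}-\bar g_{ad}\bar g_{bc})$ for some $\Lambda\in\mathbb R$. An *extended Kerr–Schild* (xKS) metric over $\bar g$ is a smooth Lorentzian metric $$g_{ab}=\bar g_{ab}-2\mathcal H\,k_ak_b-2\mathcal K\,k_{(a}m_{b)},\qquad k_{(a}m_{b)}=\tfrac12(k_am_b+k_bm_a),$$ where $\mathcal H,\mathcal K$ are smooth functions, $k$ is a smooth nowhere vanishing null vector field and $m$ a smooth unit spacelike vector field orthogonal to it: $g_{ab}k^ak^b=0$, $g_{ab}k^am^b=0$, $g_{ab}m^am^b=1$, with $k_a=g_{ab}k^b$, $m_a=g_{ab}m^b$. A *generalized Kerr–Schild* (GKS) metric is defined in the same way without the term containing $\mathcal K$ and $m$. The field $k$ is *geodetic* if $k^b\nabla_bk^a$ is proportional to $k^a$ at every point. A null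 frame at a point consists of null vectors $\ell,\mathbf n$ with $\ell\cdot\mathbf n=1$ and $n-2$ orthonormal spacelike vectors $m_{(i)}$ orthogonal to both. A frame index $0$, $1$, $i$ of the Weyl tensor $C_{abcd}$ denotes contraction with $\ell$, $\mathbf n$, $m_{(i)}$. The vector $\ell$ is a *Weyl aligned null direction* (WAND) at the point if it belongs to a null frame and $C_{0i0j}=0$ for all $i,j$ in every null frame containing it as $\ell$; it is a *multiple WAND* if moreover the boost weight $1$ components $C_{010i}$ and $C_{0ijk}$ vanish in every such frame. A spacetime is of *Weyl type I or more special* if it admits a WAND at every point. 1. If $k$ is geodetic, then the xKS spacetime $(U,g)$ is of Weyl type I or more special, and $k$ is a WAND at every point; that is, $C_{0i0j}=0$ for $\ell=k$. 2. Every GKS spacetime with geodetic $k$ has $k$ as a multiple WAND at every point: $C_{0i0j}=C_{010i}=C_{0ijk}=0$ for $\ell=k$. In contrast, for every $n\ge4$ there is an xKS spacetime with geodetic $k$ in which, at some point and in some null frame with $\ell=k$, some component $C_{010i}$ and some component $C_{0ijk}$ do not vanish. -/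

import Mathlib

open scoped ContDiff Matrix

noncomputable section

namespace KerrSchild

/-! Pseudo-Riemannian geometry in a coordinate domain `U ⊆ ℝⁿ`: a tensor field is given by its
components as functions of the coordinates. -/

/-- Coordinate `n`-tuples: points of a coordinate domain, and component tuples of vectors. -/
abbrev Coords (n : ℕ) : Type := Fin n → ℝ

/-- The components `g_{ab}(x)` of a covariant `2`-tensor field. -/
abbrev MetricField (n : ℕ) : Type := Coords n → Matrix (Fin n) (Fin n) ℝ

variable {n : ℕ}

/-- The partial derivative `∂f/∂xᵃ` at `x`. -/
def pd (a : Fin n) (f : Coords n → ℝ) (x : Coords n) : ℝ :=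
  fderiv ℝ f x (Pi.single a 1)

/-- The Minkowski matrix `diag(-1, 1, …, 1)`. -/
def minkowski (n : ℕ) : Matrix (Fin n) (Fin n) ℝ :=
  Matrix.diagonal fun a => if a.val = 0 then -1 else 1

/-- `g` is a smooth metric of Lorentzian signature `(-, +, …, +)` on `U`. -/
structure IsLorentzMetricOn (U : Set (Coords n)) (g : MetricField n) : Prop where
  smooth : ∀ a b, ContDiffOn ℝ ∞ (fun x => g x a b) U
  signature : ∀ x ∈ U, ∃ P : Matrix (Fin n) (Fin n) ℝ,
    IsUnit P.det ∧ Pᵀ * g x * P = minkowski n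

/-- The Christoffel symbols `Γᵃ_{bc}` of `g`. -/
def christoffel (g : MetricField n) (a b c : Fin n) (x : Coords n) : ℝ :=
  (1 / 2) * ∑ d, (g x)⁻¹ a d *
    (pd b (fun y => g y d c) x + pd c (fun y => g y d b) x - pd d (fun y => g y b c) x)

/-- The curvature tensor `Rᵃ_{bcd}`, with the sign for which round spheres have positive
Ricci curvature. -/
def riemannUp (g : MetricField n) (a b c d : Fin n) (x : Coords n) : ℝ :=
  pd c (christoffel g a b d) x - pd d (christoffel g a b c) x
    + ∑ e, (christoffel g a c e x * christoffel g e b d x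
      - christoffel g a d e x * christoffel g e b c x)

/-- The curvature tensor `R_{abcd}` with all indices lowered. -/
def riemann (g : MetricField n) (a b c d : Fin n) (x : Coords n) : ℝ :=
  ∑ e, g x a e * riemannUp g e b c d x

/-- The Ricci tensor `R_{ab} = Rᶜ_{acb}`. -/
def ricci (g : MetricField n) (a b : Fin n) (x : Coords n) : ℝ :=
  ∑ c, riemannUp g c a c b x

/-- The Ricci scalar `R = gᵃᵇ R_{ab}`. -/
def scalarCurvature (g : MetricField n) (x : Coords n) : ℝ :=
  ∑ a, ∑ b, (g x)⁻¹ a b * ricci g a b x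

/-- The Weyl tensor `C_{abcd}` (for `n > 3`). -/
def weyl (g : MetricField n) (a b c d : Fin n) (x : Coords n) : ℝ :=
  riemann g a b c d x
    - 1 / ((n : ℝ) - 2) *
      ((g x a c * ricci g d b x - g x a d * ricci g c b x)
        - (g x b c * ricci g d a x - g x b d * ricci g c a x))
    + 1 / (((n : ℝ) - 1) * ((n : ℝ) - 2)) * scalarCurvature g x *
      (g x a c * g x d b - g x a d * g x c b)

/-- The contraction `C_{abcd} pᵃ qᵇ rᶜ sᵈ` at `x`. -/
def weylOn (g : MetricField n) (x p q r s : Coords n) : ℝ :=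
  ∑ a, ∑ b, ∑ c, ∑ d, weyl g a b c d x * p a * q b * r c * s d

/-- The scalar product `g_{ab} vᵃ wᵇ`, for the matrix `G` of components of `g` at a point. -/
def ip (G : Matrix (Fin n) (Fin n) ℝ) (v w : Coords n) : ℝ :=
  ∑ a, ∑ b, G a b * v a * w b

/-- Lowering an index: `v_a = g_{ab} vᵇ`. -/
def lower (G : Matrix (Fin n) (Fin n) ℝ) (v : Coords n) (a : Fin n) : ℝ :=
  ∑ b, G a b * v b

/-- The component `vᵇ ∇_b vᵃ` of the acceleration of a vector field `v`. -/
def acceleration (g : MetricField n) (v : Coords n → Coords n) (a : Fin n) (x : Coords n) : ℝ :=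
  ∑ b, v x b * (pd b (fun y => v y a) x + ∑ c, christoffel g a b c x * v x c)

/-- `v` is geodetic on `U`: `vᵇ ∇_b vᵃ` is proportional to `vᵃ` (the parametrization of the
integral curves need not be affine). -/
def IsGeodeticOn (U : Set (Coords n)) (g : MetricField n) (v : Coords n → Coords n) : Prop :=
  ∀ x ∈ U, ∃ c : ℝ, ∀ a, acceleration g v a x = c * v x a

/-- A real null frame at a point where the metric has the components `G`: null vectors
`ell`, `nn` with `ell · nn = 1`, and `n - 2` orthonormal spacelike vectors `mm i` orthogonal to
both of them. -/
structure NullFrame (G : Matrix (Fin n) (Fin n) ℝ) where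
  ell : Coords n
  nn : Coords n
  mm : Fin (n - 2) → Coords n
  ell_null : ip G ell ell = 0
  nn_null : ip G nn nn = 0
  ell_nn : ip G ell nn = 1
  ell_mm : ∀ i, ip G ell (mm i) = 0
  nn_mm : ∀ i, ip G nn (mm i) = 0
  mm_mm : ∀ i j, ip G (mm i) (mm j) = if i = j then 1 else 0

/-- `C_{0i0j}`, of boost weight `2` (the frame index `0` stands for contraction with `ell`). -/
def weyl0i0j (g : MetricField n) (x : Coords n) (F : NullFrame (g x)) (i j : Fin (n - 2)) : ℝ :=
  weylOn g x F.ell (F.mm i) F.ell (F.mm j)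

/-- `C_{010i}`, of boost weight `1` (the frame index `1` stands for contraction with `nn`). -/
def weyl010i (g : MetricField n) (x : Coords n) (F : NullFrame (g x)) (i : Fin (n - 2)) : ℝ :=
  weylOn g x F.ell F.nn F.ell (F.mm i)

/-- `C_{0ijk}`, of boost weight `1`. -/
def weyl0ijk (g : MetricField n) (x : Coords n) (F : NullFrame (g x))
    (i j k : Fin (n - 2)) : ℝ :=
  weylOn g x F.ell (F.mm i) (F.mm j) (F.mm k)

/-- `l` is a Weyl aligned null direction at `x`: it can be completed to a null frame, and the
boost weight `2` components of the Weyl tensor vanish in every such frame. -/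
def IsWAND (g : MetricField n) (x l : Coords n) : Prop :=
  (∃ F : NullFrame (g x), F.ell = l) ∧
    ∀ F : NullFrame (g x), F.ell = l → ∀ i j, weyl0i0j g x F i j = 0

/-- `l` is a multiple WAND at `x`: the components of boost weight `1` vanish as well. -/
def IsMultipleWAND (g : MetricField n) (x l : Coords n) : Prop :=
  IsWAND g x l ∧ ∀ F : NullFrame (g x), F.ell = l →
    (∀ i, weyl010i g x F i = 0) ∧ ∀ i j k, weyl0ijk g x F i j k = 0

/-- The spacetime `(U, g)` is of Weyl type I or more special: a WAND exists at every point. -/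
def IsWeylTypeIOrMoreSpecial (U : Set (Coords n)) (g : MetricField n) : Prop :=
  ∀ x ∈ U, ∃ l, IsWAND g x l

/-- `(U, g)` is, locally, de Sitter (`Λ > 0`), Minkowski (`Λ = 0`) or anti-de Sitter (`Λ < 0`)
spacetime with cosmological constant `Λ`, in arbitrary coordinates: a Lorentzian metric of
constant curvature, with `R_{ab} = 2Λ/(n-2) g_{ab}`. -/
structure IsMaximallySymmetricOn (L : ℝ) (U : Set (Coords n)) (g : MetricField n) : Prop where
  lorentz : IsLorentzMetricOn U g
  curvature : ∀ x ∈ U, ∀ a b c d, riemann g a b c d x =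
    2 * L / (((n : ℝ) - 2) * ((n : ℝ) - 1)) * (g x a c * g x b d - g x a d * g x b c)

/-! The canonical conformally flat metrics are instances of this definition. -/

/-- The conformally flat form `Ω η` of the de Sitter and anti-de Sitter metrics, with
`Ω = -η_{ss} (n-2)(n-1) / (2 Λ x_s²)`: `s` is the time coordinate for `Λ > 0` and a space
coordinate for `Λ < 0`. -/
def canonicalMetric (n : ℕ) (L : ℝ) (s : Fin n) : MetricField n := fun x =>
  (-(minkowski n s s) * (((n : ℝ) - 2) * ((n : ℝ) - 1)) / (2 * L) * ((x s) ^ 2)⁻¹) • minkowski n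

theorem pd_inv_sq (A : ℝ) (s b : Fin n) (x : Coords n) (hx : x s ≠ 0) :
    pd b (fun y => A * ((y s) ^ 2)⁻¹) x = if b = s then -2 * A * ((x s) ^ 3)⁻¹ else 0 := by
  have h1 : HasFDerivAt (fun y : Coords n => y s)
      (ContinuousLinearMap.proj (R := ℝ) (φ := fun _ : Fin n => ℝ) s) x := hasFDerivAt_apply s x
  have h2 : HasDerivAt (fun t : ℝ => A * (t ^ 2)⁻¹) (-2 * A * ((x s) ^ 3)⁻¹) (x s) := by
    have := ((hasDerivAt_pow 2 (x s)).fun_inv (pow_ne_zero 2 hx)).const_mul A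
    refine this.congr_deriv ?_
    field_simp
    norm_num
    ring
  have h3 := h2.comp_hasFDerivAt x h1
  have h4 : fderiv ℝ (fun y : Coords n => A * ((y s) ^ 2)⁻¹) x = _ := h3.fderiv
  rw [pd, h4]
  by_cases h : b = s
  · subst h; simp
  · simp [h, Ne.symm h]

theorem pd_inv (A : ℝ) (s b : Fin n) (x : Coords n) (hx : x s ≠ 0) :
    pd b (fun y => A * (y s)⁻¹) x = if b = s then -A * ((x s) ^ 2)⁻¹ else 0 := by
  have h1 : HasFDerivAt (fun y : Coords n => y s)
      (ContinuousLinearMap.proj (R := ℝ) (φ := fun _ : Fin n => ℝ) s) x := hasFDerivAt_apply s x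
  have h2 : HasDerivAt (fun t : ℝ => A * t⁻¹) (-A * ((x s) ^ 2)⁻¹) (x s) := by
    refine ((hasDerivAt_inv hx).const_mul A).congr_deriv ?_
    ring
  have h3 := h2.comp_hasFDerivAt x h1
  have h4 : fderiv ℝ (fun y : Coords n => A * (y s)⁻¹) x = _ := h3.fderiv
  rw [pd, h4]
  by_cases h : b = s
  · subst h; simp
  · simp [h, Ne.symm h]

theorem minkowski_comm (a b : Fin n) : minkowski n a b = minkowski n b a := by
  have : (minkowski n)ᵀ = minkowski n := by rw [minkowski, Matrix.diagonal_transpose]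
  exact congrFun (congrFun this b) a

theorem minkowski_mul_self : minkowski n * minkowski n = 1 := by
  rw [minkowski, Matrix.diagonal_mul_diagonal, ← Matrix.diagonal_one]
  congr 1; funext a; split_ifs <;> norm_num

theorem sum_minkowski (a b : Fin n) :
    ∑ e, minkowski n a e * minkowski n e b = if a = b then 1 else 0 := by
  rw [← Matrix.mul_apply, minkowski_mul_self, Matrix.one_apply]

/-- `-x_s Γᵃ_{bc}` for the metric `A η / x_s²`. -/
def confGamma (s a b c : Fin n) : ℝ :=
  (if b = s then 1 else 0) * (if a = c then 1 else 0)
    + (if c = s then 1 else 0) * (if a = b then 1 else 0)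
    - minkowski n a s * minkowski n b c

theorem christoffel_conformal (A : ℝ) (hA : A ≠ 0) (s a b c : Fin n) (x : Coords n)
    (hx : x s ≠ 0) :
    christoffel (fun y => (A * ((y s) ^ 2)⁻¹) • minkowski n) a b c x =
      -confGamma s a b c * (x s)⁻¹ := by
  have hinv : ((A * ((x s) ^ 2)⁻¹) • minkowski n)⁻¹ = (A⁻¹ * (x s) ^ 2) • minkowski n := by
    apply Matrix.inv_eq_left_inv
    rw [Matrix.smul_mul, Matrix.mul_smul, minkowski_mul_self, smul_smul]
    have : A⁻¹ * x s ^ 2 * (A * (x s ^ 2)⁻¹) = 1 := by field_simp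
    rw [this, one_smul]
  have hpd : ∀ e p q : Fin n,
      pd e (fun y : Coords n => ((A * ((y s) ^ 2)⁻¹) • minkowski n) p q) x =
        -2 * A * ((x s) ^ 3)⁻¹ * ((if e = s then 1 else 0) * minkowski n p q) := by
    intro e p q
    have h := pd_inv_sq (A * minkowski n p q) s e x hx
    have h' : (fun y : Coords n => ((A * ((y s) ^ 2)⁻¹) • minkowski n) p q)
        = fun y => A * minkowski n p q * ((y s) ^ 2)⁻¹ := by
      funext y; simp only [Matrix.smul_apply, smul_eq_mul]; ring
    rw [h', h]; split_ifs <;> ring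
  unfold christoffel
  simp only [hpd, hinv, confGamma]
  simp only [Matrix.smul_apply, smul_eq_mul]
  rw [← sum_minkowski a c, ← sum_minkowski a b]
  have h3 : minkowski n a s = ∑ e, minkowski n a e * if e = s then 1 else 0 := by simp
  rw [h3]
  simp only [Finset.mul_sum, Finset.sum_mul, ← Finset.sum_add_distrib, ← Finset.sum_sub_distrib,
    ← Finset.sum_neg_distrib]
  refine Finset.sum_congr rfl fun e _ => ?_
  field_simp
  ring

theorem sum_confGamma (s a b c d : Fin n) :
    (if c = s then 1 else 0) * confGamma s a b d - (if d = s then 1 else 0) * confGamma s a b c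
      + ∑ e, (confGamma s a c e * confGamma s e b d - confGamma s a d e * confGamma s e b c) =
    -(minkowski n s s) * ((if a = c then 1 else 0) * minkowski n b d
      - (if a = d then 1 else 0) * minkowski n b c) := by
  have key : ∀ c d : Fin n, ∑ e, confGamma s a c e * confGamma s e b d =
      (if c = s then 1 else 0) * confGamma s a b d
      + (if a = c then 1 else 0) * confGamma s s b d
      - minkowski n a s * ((if b = s then 1 else 0) * minkowski n c d
        + (if d = s then 1 else 0) * minkowski n c b
        - (if c = s then 1 else 0) * minkowski n b d) := by
    intro c d
    nth_rewrite 2 [← sum_minkowski c s]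
    have h1 : confGamma s a b d = ∑ e, (if a = e then 1 else 0) * confGamma s e b d := by simp
    have h2 : confGamma s s b d = ∑ e, (if e = s then 1 else 0) * confGamma s e b d := by simp
    have h3 : minkowski n c d = ∑ e, minkowski n c e * (if e = d then 1 else 0) := by simp
    have h4 : minkowski n c b = ∑ e, minkowski n c e * (if e = b then 1 else 0) := by simp
    rw [h1, h2, h3, h4]
    simp only [Finset.mul_sum, Finset.sum_mul, ← Finset.sum_add_distrib,
      ← Finset.sum_sub_distrib]
    refine Finset.sum_congr rfl fun e _ => ?_
    simp only [confGamma]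
    ring
  rw [Finset.sum_sub_distrib, key, key]
  simp only [confGamma, minkowski_comm d c, minkowski_comm d b, minkowski_comm c b,
    eq_comm (a := s)]
  ring

/-- The Minkowski metric in Cartesian coordinates. -/
theorem minkowski_isMaximallySymmetricOn :
    IsMaximallySymmetricOn 0 Set.univ (fun _ : Coords n => minkowski n) := by
  refine ⟨⟨fun a b => contDiffOn_const, fun x _ => ⟨1, by simp, by simp⟩⟩, ?_⟩
  intro x _ a b c d
  have hc : ∀ a b c, christoffel (fun _ : Coords n => minkowski n) a b c = fun _ => 0 := by
    intro a b c; funext y; simp [christoffel, pd]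
  simp [riemann, riemannUp, hc, pd]

/-- The canonical metrics are (anti-)de Sitter spacetimes. -/
theorem canonicalMetric_isMaximallySymmetricOn (hn : 2 < n) (L : ℝ) (s : Fin n)
    (hL : 0 < -(minkowski n s s) * L) :
    IsMaximallySymmetricOn L {x | x s ≠ 0} (canonicalMetric n L s) := by
  have hn1 : (2 : ℝ) < n := by exact_mod_cast hn
  have hL0 : L ≠ 0 := by rintro rfl; simp at hL
  obtain ⟨A, hA⟩ : ∃ A, A = -(minkowski n s s) * (((n : ℝ) - 2) * ((n : ℝ) - 1)) / (2 * L) :=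
    ⟨_, rfl⟩
  have hA0 : 0 < A := by
    have h1 : 0 < (-(minkowski n s s) * L) * (((n : ℝ) - 2) * ((n : ℝ) - 1)) / (2 * L ^ 2) := by
      have : 0 < (n : ℝ) - 2 := by linarith
      have : 0 < (n : ℝ) - 1 := by linarith
      positivity
    rw [hA]
    convert h1 using 1
    field_simp
  have hAL : 2 * L / (((n : ℝ) - 2) * ((n : ℝ) - 1)) * A = -(minkowski n s s) := by
    have : (n : ℝ) - 2 ≠ 0 := by linarith
    have : (n : ℝ) - 1 ≠ 0 := by linarith
    rw [hA]; field_simp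
  have hg : canonicalMetric n L s = fun y => (A * ((y s) ^ 2)⁻¹) • minkowski n := by
    rw [hA]; rfl
  rw [hg]
  refine ⟨⟨fun a b => ?_, fun x hx => ?_⟩, fun x hx a b c d => ?_⟩
  · simp only [Matrix.smul_apply, smul_eq_mul]
    refine ContDiffOn.mul (ContDiffOn.mul contDiffOn_const (ContDiffOn.inv ?_ ?_)) contDiffOn_const
    · fun_prop
    · intro x hx; exact pow_ne_zero 2 hx
  · have hx' : x s ≠ 0 := hx
    have hpos : 0 < A * ((x s) ^ 2)⁻¹ := by positivity
    refine ⟨(Real.sqrt (A * ((x s) ^ 2)⁻¹))⁻¹ • 1, ?_, ?_⟩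
    · rw [Matrix.det_smul, Matrix.det_one, mul_one]
      exact (pow_ne_zero _ (inv_ne_zero (Real.sqrt_pos.2 hpos).ne')).isUnit
    · simp only [Matrix.transpose_smul, Matrix.transpose_one, Matrix.smul_mul, Matrix.mul_smul,
        Matrix.one_mul, Matrix.mul_one, smul_smul]
      have h0 := (Real.sqrt_pos.2 hpos).ne'
      have h1 : (Real.sqrt (A * (x s ^ 2)⁻¹))⁻¹ * (Real.sqrt (A * (x s ^ 2)⁻¹))⁻¹
          * (A * (x s ^ 2)⁻¹) = 1 := by
        rw [← mul_inv, Real.mul_self_sqrt hpos.le, inv_mul_cancel₀ hpos.ne']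
      convert one_smul ℝ (minkowski n) using 2
      rw [← h1]; ring
  · have hx' : x s ≠ 0 := hx
    have hopen : ∀ᶠ y in nhds x, y s ≠ 0 := (continuous_apply s).continuousAt.eventually_ne hx'
    have hpdc : ∀ e a b c,
        pd e (christoffel (fun y => (A * ((y s) ^ 2)⁻¹) • minkowski n) a b c) x =
          (if e = s then 1 else 0) * confGamma s a b c * ((x s) ^ 2)⁻¹ := by
      intro e a b c
      have : christoffel (fun y => (A * ((y s) ^ 2)⁻¹) • minkowski n) a b c =ᶠ[nhds x]
          fun y => -confGamma s a b c * (y s)⁻¹ :=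
        hopen.mono fun y hy => christoffel_conformal A hA0.ne' s a b c y hy
      have h2 := pd_inv (-confGamma s a b c) s e x hx'
      unfold pd at h2 ⊢
      rw [this.fderiv_eq, h2]; split_ifs <;> simp
    have hR : ∀ a b c d, riemannUp (fun y => (A * ((y s) ^ 2)⁻¹) • minkowski n) a b c d x =
        -(minkowski n s s) * ((if a = c then 1 else 0) * minkowski n b d
          - (if a = d then 1 else 0) * minkowski n b c) * ((x s) ^ 2)⁻¹ := by
      intro a b c d
      rw [← sum_confGamma]
      unfold riemannUp
      simp only [hpdc, christoffel_conformal A hA0.ne' s _ _ _ x hx']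
      rw [add_mul, sub_mul, Finset.sum_mul]
      congr 1
      refine Finset.sum_congr rfl fun e _ => ?_
      field_simp
    have h3 : ∀ p, minkowski n a p = ∑ e, minkowski n a e * (if e = p then 1 else 0) := by simp
    unfold riemann
    simp only [hR, Matrix.smul_apply, smul_eq_mul]
    rw [h3 c, h3 d, ← hAL]
    simp only [Finset.mul_sum, Finset.sum_mul, ← Finset.sum_sub_distrib]
    refine Finset.sum_congr rfl fun e _ => ?_
    ring

/-- `g` is an extended Kerr–Schild metric on the open set `U`,
`g_{ab} = ḡ_{ab} - 2 H k_a k_b - 2 K k_{(a} m_{b)}`,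
with a background `ḡ` that is de Sitter, Minkowski or anti-de Sitter, a null vector field `k`
and a unit spacelike vector field `m` orthogonal to `k`, both with respect to the full metric,
by which their indices are lowered. -/
structure IsExtendedKerrSchild (L : ℝ) (U : Set (Coords n)) (g gbar : MetricField n)
    (H K : Coords n → ℝ) (k m : Coords n → Coords n) : Prop where
  isOpen : IsOpen U
  metric : IsLorentzMetricOn U g
  background : IsMaximallySymmetricOn L U gbar
  smooth_H : ContDiffOn ℝ ∞ H U
  smooth_K : ContDiffOn ℝ ∞ K U
  smooth_k : ContDiffOn ℝ ∞ k U
  smooth_m : ContDiffOn ℝ ∞ m U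
  k_ne : ∀ x ∈ U, k x ≠ 0
  k_null : ∀ x ∈ U, ip (g x) (k x) (k x) = 0
  k_m : ∀ x ∈ U, ip (g x) (k x) (m x) = 0
  m_unit : ∀ x ∈ U, ip (g x) (m x) (m x) = 1
  ansatz : ∀ x ∈ U, ∀ a b, g x a b = gbar x a b
    - 2 * H x * lower (g x) (k x) a * lower (g x) (k x) b
    - K x * (lower (g x) (k x) a * lower (g x) (m x) b
      + lower (g x) (k x) b * lower (g x) (m x) a)

/-- `g` is a generalized Kerr–Schild (GKS) metric on the open set `U`,
`g_{ab} = ḡ_{ab} - 2 H k_a k_b`, with `ḡ` and `k` as above. -/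
structure IsGeneralizedKerrSchild (L : ℝ) (U : Set (Coords n)) (g gbar : MetricField n)
    (H : Coords n → ℝ) (k : Coords n → Coords n) : Prop where
  isOpen : IsOpen U
  metric : IsLorentzMetricOn U g
  background : IsMaximallySymmetricOn L U gbar
  smooth_H : ContDiffOn ℝ ∞ H U
  smooth_k : ContDiffOn ℝ ∞ k U
  k_ne : ∀ x ∈ U, k x ≠ 0
  k_null : ∀ x ∈ U, ip (g x) (k x) (k x) = 0
  ansatz : ∀ x ∈ U, ∀ a b, g x a b = gbar x a b
    - 2 * H x * lower (g x) (k x) a * lower (g x) (k x) b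

end KerrSchild

end

open KerrSchild

/-!
The curvature tensors of the Kerr–Schild metric `g` and of its background `gbar` are compared along
`k`. The vector field `k` is null for both metrics and has the same lowered components `k_a`; its
covariant derivatives differ by `T = ∇̄ k - ∇ k`, and the Ricci identity expresses the difference of
the curvatures, applied to `k`, by `T` and its first derivatives
(`CommonNullGeodetic.curvature_diff`). Lowering an index of `T` with `gbar` gives half the Lie
derivative of `gbar - g` along `k` up to an algebraic term
(`CommonNullGeodetic.lower_covDerivDiff`). As `k` is geodetic, the Lie derivative of `k_a` is
proportional to `k_a`, so the Kerr–Schild ansatz forces `Tᵃ_b = kᵃ f_b + Vᵃ k_b` with `f_b kᵇ = 0`;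
without the term in `m`, `Tᵃ_b` is a multiple of `kᵃ k_b`.

In the extended case this implies that the components `R(Z, k, k, X)` with `Z` and `X` orthogonal to
`k` agree for the two metrics (`CommonNullGeodetic.curvature_diff_null`). They vanish for the
background, which has constant curvature. In other words, `g` and `gbar` have the same optical
matrix of `k`, and the Sachs equation determines `R_{0i0j}` from it. In the generalized case `X` may
be arbitrary, and the components with two vectors orthogonal to `k` in the last pair vanish too
(`CommonNullGeodetic.curvature_diff_transverse`), because the difference of the connections maps
vectors orthogonal to `k` to multiples of `k`.

The Weyl components also contain `R_{00}` and `R_{0i}`. Each is the trace of an endomorphism that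
kills `k`, has image orthogonal to `k`, and acts trivially on the quotient of the orthogonal space
of `k` by `k`; such an endomorphism is trace-free (`trace_eq_zero_of_quotient`). That `k` belongs
to a null frame follows by transporting it to Minkowski space and choosing an orthonormal basis of
the complement of its spatial part (`exists_nullFrame`).

For the last assertion, `η + v² (k ⊗ μ + μ ⊗ k)` with constant orthogonal vectors `k` null and `μ`
unit spacelike, and a linear function `v` with null gradient and derivatives `1` along `k` and `0`
along `μ`, is an extended Kerr–Schild metric. At the origin it agrees with `η` to first order, so its
curvature there consists of second derivatives alone, and `C_{010i} = -(n - 3) / (n - 2)` and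
`C_{0jji} = 1 / (n - 2)` for `m_{(i)} = μ` and `j ≠ i`.
-/

namespace KerrSchild

variable {n : ℕ}

/-! ### Partial derivatives -/

theorem pd_congr {f f' : Coords n → ℝ} {x : Coords n} (h : f =ᶠ[nhds x] f') (a : Fin n) :
    pd a f x = pd a f' x := by
  unfold pd; rw [h.fderiv_eq]

theorem pd_add {f f' : Coords n → ℝ} {x : Coords n} (hf : DifferentiableAt ℝ f x)
    (hf' : DifferentiableAt ℝ f' x) (a : Fin n) :
    pd a (fun y => f y + f' y) x = pd a f x + pd a f' x := by
  unfold pd; rw [fderiv_fun_add hf hf']; rfl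

theorem pd_sub {f f' : Coords n → ℝ} {x : Coords n} (hf : DifferentiableAt ℝ f x)
    (hf' : DifferentiableAt ℝ f' x) (a : Fin n) :
    pd a (fun y => f y - f' y) x = pd a f x - pd a f' x := by
  unfold pd; rw [fderiv_fun_sub hf hf']; rfl

theorem pd_mul {f f' : Coords n → ℝ} {x : Coords n} (hf : DifferentiableAt ℝ f x)
    (hf' : DifferentiableAt ℝ f' x) (a : Fin n) :
    pd a (fun y => f y * f' y) x = pd a f x * f' x + f x * pd a f' x := by
  unfold pd; rw [fderiv_fun_mul hf hf']; simp; ring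

theorem pd_sum {ι : Type*} (s : Finset ι) {f : ι → Coords n → ℝ} {x : Coords n}
    (hf : ∀ i, DifferentiableAt ℝ (f i) x) (a : Fin n) :
    pd a (fun y => ∑ i ∈ s, f i y) x = ∑ i ∈ s, pd a (f i) x := by
  unfold pd; rw [fderiv_fun_sum fun i _ => hf i]; simp

theorem pd_const (r : ℝ) (a : Fin n) (x : Coords n) : pd a (fun _ => r) x = 0 := by
  simp [pd]

theorem contDiffAt_pd {f : Coords n → ℝ} {x : Coords n} (hf : ContDiffAt ℝ ∞ f x) (a : Fin n) :
    ContDiffAt ℝ ∞ (pd a f) x :=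
  (hf.fderiv_right (m := ∞) (by simp)).clm_apply contDiffAt_const

theorem diffAt {f : Coords n → ℝ} {x : Coords n} (hf : ContDiffAt ℝ ∞ f x) :
    DifferentiableAt ℝ f x := hf.differentiableAt (by simp)

theorem pd_comm {f : Coords n → ℝ} {x : Coords n} (hf : ContDiffAt ℝ ∞ f x) (a b : Fin n) :
    pd a (pd b f) x = pd b (pd a f) x := by
  have h := hf.isSymmSndFDerivAt (by
    rw [minSmoothness_of_isRCLikeNormedField]; exact WithTop.coe_le_coe.2 le_top)
  have hd : DifferentiableAt ℝ (fderiv ℝ f) x :=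
    (hf.fderiv_right (m := ∞) (by simp)).differentiableAt (by simp)
  have key : ∀ a b : Fin n, pd a (pd b f) x
      = fderiv ℝ (fderiv ℝ f) x (Pi.single a 1) (Pi.single b 1) := by
    intro a b
    have : pd b f = fun y => fderiv ℝ f y (Pi.single b 1) := rfl
    rw [this, pd, fderiv_clm_apply hd (differentiableAt_const _)]
    simp
  rw [key, key]; exact h _ _

theorem contDiffAt_det {ι : Type*} [Fintype ι] [DecidableEq ι] {M : Coords n → Matrix ι ι ℝ}
    {x : Coords n} (hM : ∀ a b, ContDiffAt ℝ ∞ (fun y => M y a b) x) :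
    ContDiffAt ℝ ∞ (fun y => (M y).det) x := by
  simp only [Matrix.det_apply, Units.smul_def, zsmul_eq_mul]
  exact ContDiffAt.sum fun σ _ => contDiffAt_const.mul (contDiffAt_prod fun i _ => hM _ _)

theorem contDiffAt_inv_apply {ι : Type*} [Fintype ι] [DecidableEq ι]
    {M : Coords n → Matrix ι ι ℝ} {x : Coords n}
    (hM : ∀ a b, ContDiffAt ℝ ∞ (fun y => M y a b) x) (h : (M x).det ≠ 0) (a b : ι) :
    ContDiffAt ℝ ∞ (fun y => (M y)⁻¹ a b) x := by
  simp only [Matrix.inv_def, Matrix.smul_apply, Ring.inverse_eq_inv', smul_eq_mul,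
    Matrix.adjugate_apply]
  refine ((contDiffAt_det hM).inv h).mul (contDiffAt_det fun i j => ?_)
  by_cases hi : i = b
  · subst hi; simp only [Matrix.updateRow_self]; exact contDiffAt_const
  · simp only [Matrix.updateRow_ne hi]; exact hM _ _

/-! ### Levi-Civita connection and curvature -/

/-- A smooth nondegenerate metric of arbitrary signature on an open set. -/
structure IsMetricOn (U : Set (Coords n)) (g : MetricField n) : Prop where
  isOpen : IsOpen U
  smooth : ∀ x ∈ U, ∀ a b, ContDiffAt ℝ ∞ (fun y => g y a b) x
  symm : ∀ x ∈ U, ∀ a b, g x a b = g x b a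
  det : ∀ x ∈ U, (g x).det ≠ 0

theorem IsLorentzMetricOn.isMetricOn {U : Set (Coords n)} {g : MetricField n}
    (hg : IsLorentzMetricOn U g) (hU : IsOpen U) : IsMetricOn U g where
  isOpen := hU
  smooth x hx a b := (hg.smooth a b).contDiffAt (hU.mem_nhds hx)
  symm x hx a b := by
    obtain ⟨P, hP, h⟩ := hg.signature x hx
    have hmT : (minkowski n)ᵀ = minkowski n := by rw [minkowski, Matrix.diagonal_transpose]
    have h2 : Pᵀ * (g x)ᵀ * P = Pᵀ * g x * P := by
      rw [h]; rw [← hmT, ← h]; simp [Matrix.transpose_mul, Matrix.mul_assoc]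
    have hP' : IsUnit P := (Matrix.isUnit_iff_isUnit_det P).2 hP
    have hPT : IsUnit Pᵀ := (Matrix.isUnit_iff_isUnit_det _).2 (by rwa [Matrix.det_transpose])
    have h3 := hPT.mul_left_cancel (by simpa [Matrix.mul_assoc] using hP'.mul_right_cancel h2)
    exact (congrFun (congrFun h3 b) a)
  det x hx h0 := by
    obtain ⟨P, hP, h⟩ := hg.signature x hx
    have h1 := congrArg Matrix.det h
    have h2 := congrArg Matrix.det (minkowski_mul_self (n := n))
    rw [← h1] at *
    rw [Matrix.det_mul, ← h] at h2
    simp [Matrix.det_mul, h0] at h2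

theorem eqOn_pd {U : Set (Coords n)} (hU : IsOpen U) {f f' : Coords n → ℝ}
    (h : ∀ y ∈ U, f y = f' y) (a : Fin n) {x : Coords n} (hx : x ∈ U) :
    pd a f x = pd a f' x :=
  pd_congr (Filter.mem_of_superset (hU.mem_nhds hx) h) a

/-- The Christoffel symbols of the first kind. -/
noncomputable def christoffelDown (g : MetricField n) (d b c : Fin n) (x : Coords n) : ℝ :=
  (1 / 2) * (pd b (fun y => g y d c) x + pd c (fun y => g y d b) x - pd d (fun y => g y b c) x)

/-- The covariant derivative `∇_b vᵃ` of a vector field. -/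
noncomputable def covDeriv (g : MetricField n) (v : Coords n → Coords n) (a b : Fin n)
    (x : Coords n) : ℝ :=
  pd b (fun y => v y a) x + ∑ c, christoffel g a b c x * v x c

namespace IsMetricOn

variable {U : Set (Coords n)} {g : MetricField n} (hg : IsMetricOn U g) {x : Coords n} (hx : x ∈ U)

include hg hx

theorem sum_inv (a c : Fin n) : ∑ b, g x a b * (g x)⁻¹ b c = if a = c then 1 else 0 := by
  rw [← Matrix.mul_apply, Matrix.mul_nonsing_inv _ (hg.det x hx).isUnit, Matrix.one_apply]

theorem inv_sum (a c : Fin n) : ∑ b, (g x)⁻¹ a b * g x b c = if a = c then 1 else 0 := by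
  rw [← Matrix.mul_apply, Matrix.nonsing_inv_mul _ (hg.det x hx).isUnit, Matrix.one_apply]

theorem diff (a b : Fin n) : DifferentiableAt ℝ (fun y => g y a b) x := diffAt (hg.smooth x hx a b)

theorem pd_symm (a b c : Fin n) : pd c (fun y => g y a b) x = pd c (fun y => g y b a) x :=
  eqOn_pd hg.isOpen (fun y hy => hg.symm y hy a b) c hx

theorem pd_pd_symm (a b c d : Fin n) :
    pd d (pd c (fun y => g y a b)) x = pd d (pd c (fun y => g y b a)) x :=
  eqOn_pd hg.isOpen (fun _ hy => hg.pd_symm hy a b c) d hx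

theorem christoffel_symm (a b c : Fin n) : christoffel g a b c x = christoffel g a c b x := by
  unfold christoffel
  congr 1
  refine Finset.sum_congr rfl fun d _ => ?_
  rw [hg.pd_symm hx b c]; ring

theorem pd_christoffel_symm (a b c d : Fin n) :
    pd d (christoffel g a b c) x = pd d (christoffel g a c b) x :=
  eqOn_pd hg.isOpen (fun _ hy => hg.christoffel_symm hy a b c) d hx

theorem christoffelDown_symm (a b c : Fin n) :
    christoffelDown g a b c x = christoffelDown g a c b x := by
  unfold christoffelDown
  rw [hg.pd_symm hx b c]; ring

theorem lower_christoffel (d b c : Fin n) :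
    ∑ a, g x d a * christoffel g a b c x = christoffelDown g d b c x := by
  have h : ∀ a, g x d a * christoffel g a b c x
      = ∑ e, (g x d a * (g x)⁻¹ a e) * christoffelDown g e b c x := by
    intro a
    simp only [christoffel, christoffelDown, Finset.mul_sum]
    exact Finset.sum_congr rfl fun e _ => by ring
  simp only [h]
  rw [Finset.sum_comm]
  simp only [← Finset.sum_mul, hg.sum_inv hx]
  simp

/-- Metric compatibility of the Levi-Civita connection. -/
theorem pd_metric (a b c : Fin n) : pd c (fun y => g y a b) x
    = christoffelDown g a c b x + christoffelDown g b c a x := by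
  unfold christoffelDown
  rw [hg.pd_symm hx b a, hg.pd_symm hx c b, hg.pd_symm hx c a]; ring

theorem contDiffAt_christoffel (a b c : Fin n) : ContDiffAt ℝ ∞ (christoffel g a b c) x := by
  have := fun a b c => contDiffAt_pd (hg.smooth x hx a b) c
  unfold christoffel
  exact contDiffAt_const.mul (ContDiffAt.sum fun d _ =>
    (contDiffAt_inv_apply (hg.smooth x hx) (hg.det x hx) _ _).mul
      (((this _ _ _).add (this _ _ _)).sub (this _ _ _)))

theorem contDiffAt_covDeriv {v : Coords n → Coords n}
    (hv : ∀ a, ContDiffAt ℝ ∞ (fun y => v y a) x) (a b : Fin n) :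
    ContDiffAt ℝ ∞ (covDeriv g v a b) x :=
  (contDiffAt_pd (hv a) b).add
    (ContDiffAt.sum fun c _ => (hg.contDiffAt_christoffel hx a b c).mul (hv c))

/-- The Ricci identity `(∇_c ∇_d - ∇_d ∇_c) vᵃ = Rᵃ_{bcd} vᵇ`. -/
theorem ricci_identity {v : Coords n → Coords n}
    (hv : ∀ a, ContDiffAt ℝ ∞ (fun y => v y a) x) (a c d : Fin n) :
    ∑ b, riemannUp g a b c d x * v x b =
      (pd c (covDeriv g v a d) x + ∑ e, christoffel g a c e x * covDeriv g v e d x)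
      - (pd d (covDeriv g v a c) x + ∑ e, christoffel g a d e x * covDeriv g v e c x) := by
  have hΓ := fun a b c => diffAt (hg.contDiffAt_christoffel hx a b c)
  have hpd : ∀ c d, pd c (covDeriv g v a d) x = pd c (pd d (fun y => v y a)) x
      + ∑ b, (pd c (christoffel g a b d) x * v x b
        + christoffel g a d b x * pd c (fun y => v y b) x) := by
    intro c d
    have : covDeriv g v a d = fun y => pd d (fun y => v y a) y
        + ∑ c, christoffel g a d c y * v y c := rfl
    rw [this, pd_add (diffAt (contDiffAt_pd (hv a) d)) (DifferentiableAt.fun_sum fun e _ =>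
      (hΓ _ _ _).fun_mul (diffAt (hv e))), pd_sum _ fun e => (hΓ _ _ _).fun_mul (diffAt (hv e))]
    congr 1
    refine Finset.sum_congr rfl fun e _ => ?_
    rw [pd_mul (hΓ _ _ _) (diffAt (hv e)), hg.pd_christoffel_symm hx]
  have hdd : ∀ c d, ∑ e, christoffel g a c e x * covDeriv g v e d x
      = ∑ e, christoffel g a c e x * pd d (fun y => v y e) x
        + ∑ b, (∑ e, christoffel g a c e x * christoffel g e b d x) * v x b := by
    intro c d
    simp only [covDeriv, mul_add, Finset.sum_add_distrib, Finset.mul_sum, Finset.sum_mul]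
    congr 1
    rw [Finset.sum_comm]
    refine Finset.sum_congr rfl fun e _ => Finset.sum_congr rfl fun b _ => ?_
    rw [hg.christoffel_symm hx b d e]; ring
  rw [hpd, hpd, hdd, hdd, pd_comm (hv a) c d]
  simp only [riemannUp, add_mul, sub_mul, Finset.sum_add_distrib, Finset.sum_sub_distrib]
  ring

/-- The curvature tensor with lowered indices in terms of the second derivatives of the metric; its
algebraic symmetries can be read off from this form. -/
theorem riemann_eq (a b c d : Fin n) : riemann g a b c d x =
    (1 / 2) * (pd c (pd b (fun y => g y a d)) x - pd c (pd a (fun y => g y b d)) x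
      - pd d (pd b (fun y => g y a c)) x + pd d (pd a (fun y => g y b c)) x)
    - ∑ e, christoffelDown g e c a x * christoffel g e b d x
    + ∑ e, christoffelDown g e d a x * christoffel g e b c x := by
  have hΓ := fun a b c => diffAt (hg.contDiffAt_christoffel hx a b c)
  have h2 := fun a b c => diffAt (contDiffAt_pd (hg.smooth x hx a b) c)
  have h1 : ∀ c d, ∑ e, g x a e * pd c (christoffel g e b d) x
      = (1 / 2) * (pd c (pd b (fun y => g y a d)) x + pd c (pd d (fun y => g y a b)) x
        - pd c (pd a (fun y => g y b d)) x)
        - ∑ e, (christoffelDown g a c e x + christoffelDown g e c a x)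
          * christoffel g e b d x := by
    intro c d
    have e1 : pd c (christoffelDown g a b d) x
        = (1 / 2) * (pd c (pd b (fun y => g y a d)) x + pd c (pd d (fun y => g y a b)) x
        - pd c (pd a (fun y => g y b d)) x) := by
      have : christoffelDown g a b d = fun y => (1 / 2) * ((pd b (fun y => g y a d) y
        + pd d (fun y => g y a b) y) - pd a (fun y => g y b d) y) := rfl
      rw [this, pd_mul (differentiableAt_const _)
        (((h2 _ _ _).fun_add (h2 _ _ _)).fun_sub (h2 _ _ _)),
        pd_const, pd_sub ((h2 _ _ _).fun_add (h2 _ _ _)) (h2 _ _ _), pd_add (h2 _ _ _) (h2 _ _ _)]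
      ring
    have e2 : pd c (christoffelDown g a b d) x
        = pd c (fun y => ∑ e, g y a e * christoffel g e b d y) x :=
      eqOn_pd hg.isOpen (fun y hy => (hg.lower_christoffel hy a b d).symm) c hx
    rw [← e1, e2, pd_sum _ fun e => (hg.diff hx a e).fun_mul (hΓ _ _ _)]
    rw [← Finset.sum_sub_distrib]
    refine Finset.sum_congr rfl fun e _ => ?_
    rw [pd_mul (hg.diff hx a e) (hΓ _ _ _), hg.pd_metric hx]; ring
  have h3 : ∀ c d, ∑ e, g x a e * ∑ f, christoffel g e c f x * christoffel g f b d x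
      = ∑ f, christoffelDown g a c f x * christoffel g f b d x := by
    intro c d
    simp only [Finset.mul_sum]
    rw [Finset.sum_comm]
    refine Finset.sum_congr rfl fun f _ => ?_
    rw [← hg.lower_christoffel hx, Finset.sum_mul]
    exact Finset.sum_congr rfl fun e _ => by ring
  simp only [riemann, riemannUp, mul_add, mul_sub, Finset.sum_add_distrib,
    Finset.sum_sub_distrib]
  rw [h1, h1, h3, h3, pd_comm (hg.smooth x hx a b) c d]
  simp only [add_mul, Finset.sum_add_distrib]
  ring

theorem sum_christoffelDown_mul_comm (a b c d : Fin n) :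
    ∑ e, christoffelDown g e a b x * christoffel g e c d x
      = ∑ e, christoffelDown g e c d x * christoffel g e a b x := by
  simp only [← hg.lower_christoffel hx, Finset.sum_mul]
  rw [Finset.sum_comm]
  refine Finset.sum_congr rfl fun e _ => Finset.sum_congr rfl fun f _ => ?_
  rw [hg.symm x hx e f]; ring

theorem riemann_antisymm (a b c d : Fin n) : riemann g a b c d x = -riemann g b a c d x := by
  rw [hg.riemann_eq hx, hg.riemann_eq hx, hg.sum_christoffelDown_mul_comm hx c a,
    hg.sum_christoffelDown_mul_comm hx d a]
  simp only [hg.christoffelDown_symm hx _ b, hg.christoffel_symm hx _ c a,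
    hg.christoffel_symm hx _ d a]
  ring

theorem riemann_pair (a b c d : Fin n) : riemann g a b c d x = riemann g c d a b x := by
  rw [hg.riemann_eq hx, hg.riemann_eq hx, pd_comm (hg.smooth x hx _ _) a,
    pd_comm (hg.smooth x hx _ _) a, pd_comm (hg.smooth x hx _ _) b,
    pd_comm (hg.smooth x hx _ _) b, hg.sum_christoffelDown_mul_comm hx b c]
  simp only [hg.pd_pd_symm hx c b, hg.pd_pd_symm hx c a, hg.pd_pd_symm hx d b,
    hg.pd_pd_symm hx d a, hg.christoffelDown_symm hx _ a c, hg.christoffel_symm hx _ d b,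
    hg.christoffel_symm hx _ b c]
  ring

omit hg hx in
theorem riemannUp_antisymm (g : MetricField n) (a b c d : Fin n) (x : Coords n) :
    riemannUp g a b c d x = -riemannUp g a b d c x := by
  simp only [riemannUp, Finset.sum_sub_distrib]; ring

end IsMetricOn

/-! ### Two metrics with a common null geodetic vector field -/

theorem sum_lower_mul (G : Matrix (Fin n) (Fin n) ℝ) (v w : Coords n) :
    ∑ a, lower G v a * w a = ip G w v := by
  simp only [lower, ip, Finset.sum_mul]
  exact Finset.sum_congr rfl fun a _ => Finset.sum_congr rfl fun b _ => by ring

/-- Two metrics `g` and `gbar` on `U` with a common geodetic null vector field `k`, whose index is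
lowered by both metrics to the same covector field. -/
structure CommonNullGeodetic (U : Set (Coords n)) (g gbar : MetricField n)
    (k : Coords n → Coords n) : Prop where
  metric : IsMetricOn U g
  background : IsMetricOn U gbar
  smooth : ∀ x ∈ U, ∀ a, ContDiffAt ℝ ∞ (fun y => k y a) x
  ne : ∀ x ∈ U, k x ≠ 0
  null : ∀ x ∈ U, ip (g x) (k x) (k x) = 0
  geodetic : IsGeodeticOn U g k
  lower_eq : ∀ x ∈ U, ∀ a, lower (gbar x) (k x) a = lower (g x) (k x) a

/-- The tensor `∇̄_b kᵃ - ∇_b kᵃ`. -/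
noncomputable def covDerivDiff (g gbar : MetricField n) (k : Coords n → Coords n) (a b : Fin n)
    (x : Coords n) : ℝ :=
  covDeriv gbar k a b x - covDeriv g k a b x

namespace CommonNullGeodetic

variable {U : Set (Coords n)} {g gbar : MetricField n} {k : Coords n → Coords n}
  (h : CommonNullGeodetic U g gbar k) {x : Coords n} (hx : x ∈ U)

include h hx

theorem contDiffAt_lower (a : Fin n) : ContDiffAt ℝ ∞ (fun y => lower (g y) (k y) a) x :=
  ContDiffAt.sum fun b _ => (h.metric.smooth x hx a b).mul (h.smooth x hx b)

theorem sum_lower_self : ∑ a, lower (g x) (k x) a * k x a = 0 := by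
  rw [sum_lower_mul]; exact h.null x hx

theorem lower_ne : lower (g x) (k x) ≠ 0 := by
  intro h0
  refine h.ne x hx (Matrix.eq_zero_of_mulVec_eq_zero (h.metric.det x hx) ?_)
  funext a
  exact congrFun h0 a

theorem sum_metric_covDeriv (d c : Fin n) : ∑ a, g x d a * covDeriv g k a c x =
    ∑ a, g x d a * pd c (fun y => k y a) x + ∑ e, christoffelDown g d c e x * k x e := by
  simp only [covDeriv, mul_add, Finset.sum_add_distrib, Finset.mul_sum]
  congr 1
  rw [Finset.sum_comm]
  refine Finset.sum_congr rfl fun e _ => ?_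
  rw [← h.metric.lower_christoffel hx, Finset.sum_mul]
  exact Finset.sum_congr rfl fun a _ => by ring

theorem pd_lower (d c : Fin n) : pd c (fun y => lower (g y) (k y) d) x =
    ∑ a, g x d a * covDeriv g k a c x + ∑ a, christoffelDown g a c d x * k x a := by
  have hk := fun a => diffAt (h.smooth x hx a)
  unfold lower
  rw [h.sum_metric_covDeriv hx, pd_sum _ fun a => (h.metric.diff hx d a).fun_mul (hk a),
    ← Finset.sum_add_distrib, ← Finset.sum_add_distrib]
  refine Finset.sum_congr rfl fun a _ => ?_
  rw [pd_mul (h.metric.diff hx d a) (hk a), h.metric.pd_metric hx]; ring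

theorem pd_lower_mul (c : Fin n) :
    ∑ d, lower (g x) (k x) d * pd c (fun y => k y d) x
      = -∑ d, pd c (fun y => lower (g y) (k y) d) x * k x d := by
  have hk := fun a => diffAt (h.smooth x hx a)
  have hl := fun a => diffAt (h.contDiffAt_lower hx a)
  have h0 : pd c (fun y => ∑ d, lower (g y) (k y) d * k y d) x = 0 := by
    rw [← pd_const 0 c x]
    exact eqOn_pd h.metric.isOpen (fun y hy => h.sum_lower_self hy) c hx
  rw [pd_sum _ fun a => (hl a).fun_mul (hk a)] at h0
  simp only [pd_mul (hl _) (hk _), Finset.sum_add_distrib] at h0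
  linarith

/-- The covector `k_a` annihilates `∇_b kᵃ`, since `k` is null on all of `U`. -/
theorem lower_covDeriv (c : Fin n) : ∑ a, lower (g x) (k x) a * covDeriv g k a c x = 0 := by
  have h1 := h.pd_lower_mul hx c
  have hs : ∀ F : Fin n → ℝ,
      ∑ d, lower (g x) (k x) d * F d = ∑ d, (∑ a, g x d a * F a) * k x d := by
    intro F
    simp only [lower, Finset.sum_mul]
    rw [Finset.sum_comm]
    refine Finset.sum_congr rfl fun d _ => Finset.sum_congr rfl fun a _ => ?_
    rw [h.metric.symm x hx a d]; ring
  have h3 : ∑ d, (∑ e, christoffelDown g d c e x * k x e) * k x d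
      = ∑ d, (∑ a, christoffelDown g a c d x * k x a) * k x d := by
    simp only [Finset.sum_mul]
    rw [Finset.sum_comm]
    exact Finset.sum_congr rfl fun d _ => Finset.sum_congr rfl fun a _ => by ring
  have h4 : ∑ d, lower (g x) (k x) d * covDeriv g k d c x
      = ∑ d, lower (g x) (k x) d * pd c (fun y => k y d) x
        + ∑ d, (∑ e, christoffelDown g d c e x * k x e) * k x d := by
    rw [hs, hs]
    simp only [h.sum_metric_covDeriv hx, add_mul, Finset.sum_add_distrib]
  simp only [h.pd_lower hx, add_mul, Finset.sum_add_distrib] at h1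
  rw [← hs, ← h3] at h1
  linarith

/-- The exterior derivative of `k_a`, contracted with a geodetic `k`, is proportional to `k_a`. -/
theorem exterior_lower {c : ℝ} (hc : ∀ a, acceleration g k a x = c * k x a) (d : Fin n) :
    ∑ b, k x b * (pd b (fun y => lower (g y) (k y) d) x - pd d (fun y => lower (g y) (k y) b) x)
      = c * lower (g x) (k x) d := by
  have h1 : ∀ b, k x b * (pd b (fun y => lower (g y) (k y) d) x
      - pd d (fun y => lower (g y) (k y) b) x)
      = ∑ a, g x d a * (k x b * covDeriv g k a b x)
        - ∑ a, g x b a * k x b * covDeriv g k a d x := by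
    intro b
    rw [h.pd_lower hx, h.pd_lower hx]
    simp only [h.metric.christoffelDown_symm hx _ d b]
    rw [add_sub_add_right_eq_sub, mul_sub, Finset.mul_sum, Finset.mul_sum]
    congr 1 <;> exact Finset.sum_congr rfl fun _ _ => by ring
  simp only [h1, Finset.sum_sub_distrib]
  have h2 : ∑ b, ∑ a, g x b a * k x b * covDeriv g k a d x
      = ∑ a, lower (g x) (k x) a * covDeriv g k a d x := by
    rw [Finset.sum_comm]
    simp only [lower, Finset.sum_mul]
    refine Finset.sum_congr rfl fun d _ => Finset.sum_congr rfl fun a _ => ?_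
    rw [h.metric.symm x hx a d]
  have h3 : ∀ a, ∑ b, k x b * covDeriv g k a b x = c * k x a := hc
  rw [h2, h.lower_covDeriv hx, Finset.sum_comm]
  simp only [← Finset.mul_sum, h3, lower, sub_zero]
  rw [Finset.mul_sum]
  exact Finset.sum_congr rfl fun _ _ => by ring

/-- Lowering an index of `∇̄_b kᵃ - ∇_b kᵃ` by the background metric gives half the Lie derivative
of `gbar - g` along `k`, minus the contraction of `gbar - g` with `∇_b kᵃ`. -/
theorem lower_covDerivDiff (d c : Fin n) : 2 * ∑ a, gbar x d a * covDerivDiff g gbar k a c x =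
    ∑ e, k x e * pd e (fun y => gbar y d c - g y d c) x
      + ∑ a, (gbar x d a - g x d a) * pd c (fun y => k y a) x
      + ∑ a, (gbar x c a - g x c a) * pd d (fun y => k y a) x
      - 2 * ∑ a, (gbar x d a - g x d a) * covDeriv g k a c x := by
  have hk := fun a => diffAt (h.smooth x hx a)
  have hB : ∑ a, gbar x d a * covDeriv gbar k a c x =
      ∑ a, gbar x d a * pd c (fun y => k y a) x
        + ∑ e, christoffelDown gbar d c e x * k x e := by
    simp only [covDeriv, mul_add, Finset.sum_add_distrib, Finset.mul_sum]
    congr 1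
    rw [Finset.sum_comm]
    refine Finset.sum_congr rfl fun e _ => ?_
    rw [← h.background.lower_christoffel hx, Finset.sum_mul]
    exact Finset.sum_congr rfl fun a _ => by ring
  -- `gbar - g` annihilates `k` on all of `U`, so derivatives can be moved from `k` to `gbar - g`
  have hh : ∀ p q, ∑ a, (gbar x p a - g x p a) * pd q (fun y => k y a) x
      = -∑ a, pd q (fun y => gbar y p a - g y p a) x * k x a := by
    intro p q
    have h0 : pd q (fun y => ∑ a, (gbar y p a - g y p a) * k y a) x = 0 := by
      rw [← pd_const 0 q x]
      refine eqOn_pd h.metric.isOpen (fun y hy => ?_) q hx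
      have := h.lower_eq y hy p
      simp only [lower] at this
      simp only [sub_mul, Finset.sum_sub_distrib, this, sub_self]
    have hd := fun a => (h.background.diff hx p a).fun_sub (h.metric.diff hx p a)
    rw [pd_sum _ fun a => (hd a).fun_mul (hk a)] at h0
    simp only [pd_mul (hd _) (hk _), Finset.sum_add_distrib] at h0
    linarith
  have hΓ : ∀ e, 2 * (christoffelDown gbar d c e x - christoffelDown g d c e x)
      = pd c (fun y => gbar y d e - g y d e) x + pd e (fun y => gbar y d c - g y d c) x
        - pd d (fun y => gbar y c e - g y c e) x := by
    intro e
    simp only [pd_sub (h.background.diff hx _ _) (h.metric.diff hx _ _), christoffelDown]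
    ring
  have hΓ' : 2 * (∑ e, christoffelDown gbar d c e x * k x e
      - ∑ e, christoffelDown g d c e x * k x e)
      = ∑ e, pd c (fun y => gbar y d e - g y d e) x * k x e
        + ∑ e, k x e * pd e (fun y => gbar y d c - g y d c) x
        - ∑ e, pd d (fun y => gbar y c e - g y c e) x * k x e := by
    rw [← Finset.sum_sub_distrib, Finset.mul_sum, ← Finset.sum_add_distrib,
      ← Finset.sum_sub_distrib]
    refine Finset.sum_congr rfl fun e _ => ?_
    linear_combination k x e * hΓ e
  have hg := h.sum_metric_covDeriv hx d c
  have h1 := hh d c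
  have h2 := hh c d
  simp only [covDerivDiff, mul_sub, sub_mul, Finset.sum_sub_distrib] at h1 h2 ⊢
  linarith

theorem contDiffAt_covDerivDiff (a b : Fin n) :
    ContDiffAt ℝ ∞ (covDerivDiff g gbar k a b) x :=
  (h.background.contDiffAt_covDeriv hx (h.smooth x hx) a b).sub
    (h.metric.contDiffAt_covDeriv hx (h.smooth x hx) a b)

omit h hx in
theorem covDerivDiff_eq (a b : Fin n) (x : Coords n) : covDerivDiff g gbar k a b x
    = ∑ e, (christoffel gbar a b e x - christoffel g a b e x) * k x e := by
  simp only [covDerivDiff, covDeriv, sub_mul, Finset.sum_sub_distrib]; ring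

theorem sum_covDerivDiff (a e : Fin n) :
    ∑ c, k x c * (christoffel gbar a c e x - christoffel g a c e x)
      = covDerivDiff g gbar k a e x := by
  rw [covDerivDiff_eq]
  refine Finset.sum_congr rfl fun c _ => ?_
  rw [h.background.christoffel_symm hx a c e, h.metric.christoffel_symm hx a c e]; ring

/-- The difference of the curvature tensors of `gbar` and `g`, applied to `k`, when
`∇̄_b kᵃ - ∇_b kᵃ = kᵃ f_b + Vᵃ k_b`, contracted with a covector `Z` and two vectors. The term
written out is antisymmetrized in `p` and `X`. -/
theorem curvature_diff {f V : Coords n → Coords n}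
    (hf : ∀ a, ContDiffAt ℝ ∞ (fun y => f y a) x) (hV : ∀ a, ContDiffAt ℝ ∞ (fun y => V y a) x)
    (hT : ∀ y ∈ U, ∀ a d, covDerivDiff g gbar k a d y = k y a * f y d
      + V y a * lower (g y) (k y) d) (Z p X : Coords n) :
    let E : Coords n → Coords n → ℝ := fun p X =>
      (∑ d, f x d * X d) * (∑ a, Z a * ∑ c, p c * covDeriv g k a c x)
      + (∑ a, Z a * k x a) * (∑ c, ∑ d, p c * X d * pd c (fun y => f y d) x)
      + (∑ d, lower (g x) (k x) d * X d) * (∑ a, ∑ c, Z a * p c * covDeriv g V a c x)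
      + (∑ a, Z a * V x a) * (∑ c, ∑ d, p c * X d * pd c (fun y => lower (g y) (k y) d) x)
      + ∑ a, Z a * ∑ e, (∑ c, p c * (christoffel gbar a c e x - christoffel g a c e x))
        * ∑ d, covDeriv gbar k e d x * X d
    ∑ a, ∑ c, ∑ d, Z a * p c * X d *
      ∑ b, (riemannUp gbar a b c d x - riemannUp g a b c d x) * k x b = E p X - E X p := by
  intro E
  have hk := fun a => diffAt (h.smooth x hx a)
  have hl := fun a => diffAt (h.contDiffAt_lower hx a)
  have hf' := fun a => diffAt (hf a)
  have hV' := fun a => diffAt (hV a)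
  obtain ⟨e, he⟩ : ∃ e : Fin n → Fin n → Fin n → ℝ, ∀ a c d, e a c d =
    f x d * covDeriv g k a c x + k x a * pd c (fun y => f y d) x
      + lower (g x) (k x) d * covDeriv g V a c x
      + V x a * pd c (fun y => lower (g y) (k y) d) x
      + ∑ b, (christoffel gbar a c b x - christoffel g a c b x) * covDeriv gbar k b d x :=
    ⟨_, fun _ _ _ => rfl⟩
  have hpd : ∀ a c d, pd c (covDeriv gbar k a d) x - pd c (covDeriv g k a d) x
      = pd c (fun y => k y a) x * f x d + k x a * pd c (fun y => f y d) x
        + (pd c (fun y => V y a) x * lower (g x) (k x) d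
        + V x a * pd c (fun y => lower (g y) (k y) d) x) := by
    intro a c d
    rw [← pd_mul (hk a) (hf' d), ← pd_mul (hV' a) (hl d),
      ← pd_add ((hk a).fun_mul (hf' d)) ((hV' a).fun_mul (hl d)), ← pd_sub
      (diffAt (h.background.contDiffAt_covDeriv hx (h.smooth x hx) a d))
      (diffAt (h.metric.contDiffAt_covDeriv hx (h.smooth x hx) a d))]
    exact eqOn_pd h.metric.isOpen (fun y hy => hT y hy a d) c hx
  -- the difference of the two Ricci identities, before contraction
  have hR : ∀ a c d, ∑ b, (riemannUp gbar a b c d x - riemannUp g a b c d x) * k x b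
      = e a c d - e a d c := by
    intro a c d
    simp only [sub_mul, Finset.sum_sub_distrib]
    rw [h.background.ricci_identity hx (h.smooth x hx), h.metric.ricci_identity hx (h.smooth x hx)]
    have key : ∀ c d, e a c d = (pd c (covDeriv gbar k a d) x
        + ∑ e, christoffel gbar a c e x * covDeriv gbar k e d x)
        - (pd c (covDeriv g k a d) x + ∑ e, christoffel g a c e x * covDeriv g k e d x) := by
      intro c d
      have h1 : ∑ b, christoffel g a c b x * covDeriv gbar k b d x
          = ∑ b, christoffel g a c b x * covDeriv g k b d x
            + (∑ b, christoffel g a c b x * k x b) * f x d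
            + (∑ b, christoffel g a c b x * V x b) * lower (g x) (k x) d := by
        rw [Finset.sum_mul, Finset.sum_mul, ← Finset.sum_add_distrib, ← Finset.sum_add_distrib]
        refine Finset.sum_congr rfl fun b _ => ?_
        have := hT x hx b d
        rw [covDerivDiff] at this
        linear_combination christoffel g a c b x * this
      rw [he]
      simp only [sub_mul, Finset.sum_sub_distrib]
      rw [h1]
      have h2 : covDeriv g k a c x
        = pd c (fun y => k y a) x + ∑ b, christoffel g a c b x * k x b := rfl
      have h3 : covDeriv g V a c x
        = pd c (fun y => V y a) x + ∑ b, christoffel g a c b x * V x b := rfl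
      rw [h2, h3]
      linear_combination - hpd a c d
    rw [key, key]; ring
  have hE : ∀ p X : Coords n, ∑ a, ∑ c, ∑ d, Z a * p c * X d * e a c d = E p X := by
    intro p X
    simp only [he, mul_add, Finset.sum_add_distrib, E]
    congr 1
    · congr 1
      · congr 1
        · congr 1
          · rw [mul_comm, Finset.sum_mul]
            refine Finset.sum_congr rfl fun a _ => ?_
            rw [mul_assoc, Finset.sum_mul_sum, Finset.mul_sum]
            refine Finset.sum_congr rfl fun c _ => ?_
            rw [Finset.mul_sum]
            exact Finset.sum_congr rfl fun d _ => by ring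
          · rw [Finset.sum_mul]
            refine Finset.sum_congr rfl fun a _ => ?_
            rw [Finset.mul_sum]
            refine Finset.sum_congr rfl fun c _ => ?_
            rw [Finset.mul_sum]
            exact Finset.sum_congr rfl fun d _ => by ring
        · rw [mul_comm, Finset.sum_mul]
          refine Finset.sum_congr rfl fun a _ => ?_
          rw [Finset.sum_mul]
          refine Finset.sum_congr rfl fun c _ => ?_
          rw [Finset.mul_sum]
          exact Finset.sum_congr rfl fun d _ => by ring
      · rw [Finset.sum_mul]
        refine Finset.sum_congr rfl fun a _ => ?_
        rw [Finset.mul_sum]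
        refine Finset.sum_congr rfl fun c _ => ?_
        rw [Finset.mul_sum]
        exact Finset.sum_congr rfl fun d _ => by ring
    · refine Finset.sum_congr rfl fun a _ => ?_
      simp only [Finset.mul_sum, Finset.sum_mul]
      rw [Finset.sum_comm]
      refine (Finset.sum_congr rfl fun d _ => Finset.sum_comm).trans ?_
      rw [Finset.sum_comm]
      refine Finset.sum_congr rfl fun b _ => Finset.sum_congr rfl fun d _ =>
        Finset.sum_congr rfl fun c _ => by ring
  rw [← hE, ← hE]
  simp only [hR, mul_sub, Finset.sum_sub_distrib]
  congr 1
  refine Finset.sum_congr rfl fun a _ => ?_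
  rw [Finset.sum_comm]
  exact Finset.sum_congr rfl fun c _ => Finset.sum_congr rfl fun d _ => by ring

end CommonNullGeodetic

/-! ### Curvature along the null field -/

theorem sum_mul_self_ne {v : Coords n} (hv : v ≠ 0) : ∑ a, v a * v a ≠ 0 := by
  intro h0
  refine hv (funext fun a => ?_)
  have := (Finset.sum_eq_zero_iff_of_nonneg fun a _ => mul_self_nonneg (v a)).1 h0 a
    (Finset.mem_univ a)
  exact mul_self_eq_zero.1 this

/-- If a smooth matrix field is at every point of the form `kᵃ φ_d`, where `k` is smooth and nowhere
zero, then `φ` can be chosen smooth. -/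
theorem exists_smooth_factor {U : Set (Coords n)} {T : Fin n → Fin n → Coords n → ℝ}
    {k : Coords n → Coords n} (hT : ∀ x ∈ U, ∀ a d, ContDiffAt ℝ ∞ (T a d) x)
    (hk : ∀ x ∈ U, ∀ a, ContDiffAt ℝ ∞ (fun y => k y a) x) (hne : ∀ x ∈ U, k x ≠ 0)
    (hdec : ∀ x ∈ U, ∃ φ : Coords n, ∀ a d, T a d x = k x a * φ d) :
    ∃ f : Coords n → Coords n, (∀ x ∈ U, ∀ a, ContDiffAt ℝ ∞ (fun y => f y a) x) ∧
      ∀ x ∈ U, ∀ a d, T a d x = k x a * f x d := by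
  refine ⟨fun y d => (∑ a, k y a * T a d y) / ∑ a, k y a * k y a, fun x hx d => ?_,
    fun x hx a d => ?_⟩
  · exact (ContDiffAt.sum fun a _ => (hk x hx a).mul (hT x hx a d)).div
      (ContDiffAt.sum fun a _ => (hk x hx a).mul (hk x hx a)) (sum_mul_self_ne (hne x hx))
  · obtain ⟨φ, hφ⟩ := hdec x hx
    have : ∑ a, k x a * T a d x = (∑ a, k x a * k x a) * φ d := by
      rw [Finset.sum_mul]
      exact Finset.sum_congr rfl fun a _ => by rw [hφ]; ring
    simp only [this]
    rw [mul_div_cancel_left₀ _ (sum_mul_self_ne (hne x hx)), hφ]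

/-- An endomorphism `M` that kills `k`, has image in the kernel of `κ`, and induces zero on the
quotient of the kernel of `κ` by `k`, is trace-free. -/
theorem trace_eq_zero_of_quotient {M : Matrix (Fin n) (Fin n) ℝ} {k κ : Coords n} (hk : k ≠ 0)
    (hκ : κ ≠ 0) (hκk : ∑ a, κ a * k a = 0) (hMk : ∀ a, ∑ d, M a d * k d = 0)
    (hκM : ∀ d, ∑ a, κ a * M a d = 0)
    (hM : ∀ Z X : Coords n, ∑ a, Z a * k a = 0 → ∑ a, κ a * X a = 0 →
      ∑ a, ∑ d, Z a * X d * M a d = 0) : ∑ a, M a a = 0 := by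
  have hk2 := sum_mul_self_ne hk
  have hκ2 := sum_mul_self_ne hκ
  -- covectors dual to `k` and vectors dual to `κ` project onto the two hyperplanes
  obtain ⟨η, hη⟩ : ∃ η : Coords n, ∑ a, η a * k a = 1 :=
    ⟨fun a => k a / ∑ a, k a * k a, by
      simp only [div_mul_eq_mul_div, ← Finset.sum_div]; exact div_self hk2⟩
  obtain ⟨ξ, hξ⟩ : ∃ ξ : Coords n, ∑ a, κ a * ξ a = 1 :=
    ⟨fun a => κ a / ∑ a, κ a * κ a, by
      simp only [mul_div_assoc', ← Finset.sum_div]; exact div_self hκ2⟩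
  have hδ : ∀ (r : ℝ) (v F : Coords n) (e : Fin n),
      ∑ a, ((if a = e then 1 else 0) - r * v a) * F a = F e - r * ∑ a, v a * F a := by
    intro r v F e
    simp [sub_mul, Finset.mul_sum, mul_assoc]
  have h1 : ∀ e, ∑ a, ∑ d, ((if a = e then 1 else 0) - k e * η a)
      * ((if d = e then 1 else 0) - κ e * ξ d) * M a d = 0 := by
    intro e
    apply hM
    · rw [hδ, hη, mul_one, sub_self]
    · simp only [mul_comm (κ _) (_ - _)]
      rw [hδ]
      simp only [mul_comm (ξ _), hξ, mul_one, sub_self]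
  have h2 : ∀ e, ∑ a, ∑ d, ((if a = e then 1 else 0) - k e * η a)
      * ((if d = e then 1 else 0) - κ e * ξ d) * M a d
      = M e e - κ e * (∑ d, ξ d * M e d) - k e * (∑ a, η a * M a e)
        + κ e * k e * ∑ a, η a * ∑ d, ξ d * M a d := by
    intro e
    simp only [mul_assoc, ← Finset.mul_sum, hδ]
    simp only [mul_sub, Finset.sum_sub_distrib, mul_left_comm (η _), ← Finset.mul_sum]
    ring
  have h3 : ∑ e, κ e * (∑ d, ξ d * M e d) = 0 := by
    simp only [Finset.mul_sum]
    rw [Finset.sum_comm]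
    simp only [mul_left_comm (κ _), ← Finset.mul_sum, hκM, mul_zero, Finset.sum_const_zero]
  have h4 : ∑ e, k e * (∑ a, η a * M a e) = 0 := by
    simp only [Finset.mul_sum]
    rw [Finset.sum_comm]
    simp only [mul_left_comm (k _), mul_comm (k _), ← Finset.mul_sum, hMk, mul_zero,
      Finset.sum_const_zero]
  have h5 : ∑ e, (M e e - κ e * (∑ d, ξ d * M e d) - k e * (∑ a, η a * M a e)
        + κ e * k e * ∑ a, η a * ∑ d, ξ d * M a d) = 0 :=
    Finset.sum_eq_zero fun e _ => by rw [← h2, h1]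
  rw [Finset.sum_add_distrib, Finset.sum_sub_distrib, Finset.sum_sub_distrib, h3, h4,
    ← Finset.sum_mul, hκk] at h5
  linarith

/-- The curvature tensor of a metric of constant curvature, with its first index raised. -/
theorem IsMaximallySymmetricOn.riemannUp_eq {L : ℝ} {U : Set (Coords n)} {g : MetricField n}
    (hg : IsMaximallySymmetricOn L U g) (hm : IsMetricOn U g) {x : Coords n} (hx : x ∈ U)
    (a b c d : Fin n) : riemannUp g a b c d x = 2 * L / (((n : ℝ) - 2) * ((n : ℝ) - 1)) *
      ((if a = c then 1 else 0) * g x b d - (if a = d then 1 else 0) * g x b c) := by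
  have h1 : riemannUp g a b c d x = ∑ e, (g x)⁻¹ a e * riemann g e b c d x := by
    simp only [riemann, Finset.mul_sum, ← mul_assoc]
    rw [Finset.sum_comm]
    simp only [← Finset.sum_mul, hm.inv_sum hx]
    simp
  rw [h1, ← hm.inv_sum hx a c, ← hm.inv_sum hx a d]
  simp only [hg.curvature x hx, Finset.sum_mul, ← Finset.sum_sub_distrib]
  rw [Finset.mul_sum]
  exact Finset.sum_congr rfl fun e _ => by ring

/-- The curvature of a metric of constant curvature, applied to a vector `k` and contracted with a
covector `Z` and vectors `p`, `X`. -/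
theorem IsMaximallySymmetricOn.sum_riemannUp {L : ℝ} {U : Set (Coords n)} {g : MetricField n}
    (hg : IsMaximallySymmetricOn L U g) (hm : IsMetricOn U g) {x : Coords n} (hx : x ∈ U)
    (k Z p X : Coords n) :
    ∑ a, ∑ c, ∑ d, Z a * p c * X d * ∑ b, riemannUp g a b c d x * k b =
      2 * L / (((n : ℝ) - 2) * ((n : ℝ) - 1)) *
        ((∑ a, Z a * p a) * (∑ d, lower (g x) k d * X d)
          - (∑ a, Z a * X a) * (∑ c, lower (g x) k c * p c)) := by
  have h1 : ∀ a c d, ∑ b, riemannUp g a b c d x * k b =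
      2 * L / (((n : ℝ) - 2) * ((n : ℝ) - 1)) *
        ((if a = c then 1 else 0) * lower (g x) k d
          - (if a = d then 1 else 0) * lower (g x) k c) := by
    intro a c d
    simp only [hg.riemannUp_eq hm hx, lower, Finset.mul_sum, ← Finset.sum_sub_distrib]
    refine Finset.sum_congr rfl fun b _ => ?_
    rw [hm.symm x hx b d, hm.symm x hx b c]; ring
  have h2 : ∀ a c d, Z a * p c * X d * (2 * L / (((n : ℝ) - 2) * ((n : ℝ) - 1)) *
        ((if a = c then 1 else 0) * lower (g x) k d
          - (if a = d then 1 else 0) * lower (g x) k c))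
      = 2 * L / (((n : ℝ) - 2) * ((n : ℝ) - 1)) *
        ((if a = c then Z a * p c * (lower (g x) k d * X d) else 0)
          - (if a = d then Z a * X d * (lower (g x) k c * p c) else 0)) := by
    intro a c d; split_ifs <;> ring
  simp only [h1, h2, ← Finset.mul_sum, Finset.sum_sub_distrib]
  congr 2
  · rw [Finset.sum_mul]
    refine Finset.sum_congr rfl fun a _ => ?_
    rw [Finset.sum_comm]
    simp [Finset.mul_sum]
  · rw [Finset.sum_mul]
    refine Finset.sum_congr rfl fun a _ => ?_
    simp [Finset.mul_sum]

namespace CommonNullGeodetic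

variable {U : Set (Coords n)} {g gbar : MetricField n} {k : Coords n → Coords n}
  (h : CommonNullGeodetic U g gbar k) {x : Coords n} (hx : x ∈ U)

include h

/-- If `∇̄_b kᵃ - ∇_b kᵃ` is at every point of the form `kᵃ φ_b + Wᵃ k_b` with `φ_b kᵇ = 0`, then
`φ` and `W` can be chosen smooth. -/
theorem exists_smooth_decomposition
    (hT : ∀ y ∈ U, ∃ φ W : Coords n, (∀ a d, covDerivDiff g gbar k a d y
      = k y a * φ d + W a * lower (g y) (k y) d) ∧ ∑ d, φ d * k y d = 0) :
    ∃ f V : Coords n → Coords n, (∀ y ∈ U, ∀ a, ContDiffAt ℝ ∞ (fun z => f z a) y) ∧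
      (∀ y ∈ U, ∀ a, ContDiffAt ℝ ∞ (fun z => V z a) y) ∧
      (∀ y ∈ U, ∀ a d, covDerivDiff g gbar k a d y
        = k y a * f y d + V y a * lower (g y) (k y) d) ∧
      ∀ y ∈ U, ∑ d, f y d * k y d = 0 := by
  -- contracting with the Euclidean dual of `k_b` isolates `W` up to a multiple of `k`, which is
  -- absorbed in `φ`
  obtain ⟨V, hVdef⟩ : ∃ V : Coords n → Coords n, ∀ y a, V y a =
    (∑ e, covDerivDiff g gbar k a e y * lower (g y) (k y) e)
      / ∑ e, lower (g y) (k y) e * lower (g y) (k y) e := ⟨_, fun _ _ => rfl⟩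
  have hV : ∀ y ∈ U, ∀ a, ContDiffAt ℝ ∞ (fun z => V z a) y := by
    intro y hy a
    simp only [hVdef]
    exact (ContDiffAt.sum fun e _ => (h.contDiffAt_covDerivDiff hy a e).mul
      (h.contDiffAt_lower hy e)).div (ContDiffAt.sum fun e _ => (h.contDiffAt_lower hy e).mul
      (h.contDiffAt_lower hy e)) (sum_mul_self_ne (h.lower_ne hy))
  obtain ⟨f, hf, hfT⟩ := exists_smooth_factor (k := k)
    (T := fun a d y => covDerivDiff g gbar k a d y - V y a * lower (g y) (k y) d)
    (fun y hy a d => (h.contDiffAt_covDerivDiff hy a d).sub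
      ((hV y hy a).mul (h.contDiffAt_lower hy d))) h.smooth h.ne (by
    intro y hy
    obtain ⟨φ, W, hφ, -⟩ := hT y hy
    have h2 := sum_mul_self_ne (h.lower_ne hy)
    refine ⟨fun d => φ d - (∑ e, φ e * lower (g y) (k y) e)
      / (∑ e, lower (g y) (k y) e * lower (g y) (k y) e) * lower (g y) (k y) d, fun a d => ?_⟩
    have h3 : ∑ e, covDerivDiff g gbar k a e y * lower (g y) (k y) e
        = k y a * (∑ e, φ e * lower (g y) (k y) e)
          + W a * ∑ e, lower (g y) (k y) e * lower (g y) (k y) e := by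
      rw [Finset.mul_sum, Finset.mul_sum, ← Finset.sum_add_distrib]
      exact Finset.sum_congr rfl fun e _ => by rw [hφ]; ring
    simp only [hVdef]
    rw [h3, hφ]
    generalize ∑ e, lower (g y) (k y) e * lower (g y) (k y) e = s at h2 ⊢
    field_simp
    ring)
  refine ⟨f, V, hf, hV, fun y hy a d => ?_, fun y hy => ?_⟩
  · linarith [hfT y hy a d]
  · obtain ⟨φ, W, hφ, hφk⟩ := hT y hy
    obtain ⟨a, ha⟩ := Function.ne_iff.1 (h.ne y hy)
    rw [Pi.zero_apply] at ha
    have hκ := h.sum_lower_self hy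
    have e1 : ∑ d, covDerivDiff g gbar k a d y * k y d = 0 := by
      have : ∑ d, covDerivDiff g gbar k a d y * k y d = k y a * (∑ d, φ d * k y d)
          + W a * ∑ d, lower (g y) (k y) d * k y d := by
        rw [Finset.mul_sum, Finset.mul_sum, ← Finset.sum_add_distrib]
        exact Finset.sum_congr rfl fun e _ => by rw [hφ]; ring
      rw [this, hφk, hκ]; ring
    have e2 : k y a * (∑ d, f y d * k y d) = ∑ d, covDerivDiff g gbar k a d y * k y d
        - V y a * ∑ d, lower (g y) (k y) d * k y d := by
      rw [Finset.mul_sum, Finset.mul_sum, ← Finset.sum_sub_distrib]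
      refine Finset.sum_congr rfl fun d _ => ?_
      have := hfT y hy a d
      linear_combination -k y d * this
    rw [e1, hκ, mul_zero, sub_zero] at e2
    exact (mul_eq_zero.1 e2).resolve_left ha

include hx

omit h hx in
/-- For geodetic `k`, the vector `kᵇ ∇_b kᵃ` is annihilated by every covector that
annihilates `k`. -/
theorem sum_covDeriv_mul {c : ℝ} (hc : ∀ a, acceleration g k a x = c * k x a) (Z : Coords n)
    (hZ : ∑ a, Z a * k x a = 0) :
    ∑ a, Z a * ∑ b, k x b * covDeriv g k a b x = 0 := by
  have h3 : ∀ a, ∑ b, k x b * covDeriv g k a b x = c * k x a := hc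
  simp only [h3, mul_left_comm (Z _), ← Finset.mul_sum, hZ, mul_zero]

/-- The curvatures of the two metrics have the same components `Z_a Rᵃ_{bcd} kᵇ kᶜ Xᵈ` for `Z`
and `X` orthogonal to `k`, and for all `X` if moreover `∇̄_b kᵃ - ∇_b kᵃ` has only a part along
`kᵃ`. -/
theorem curvature_diff_null {f V : Coords n → Coords n}
    (hf : ∀ a, ContDiffAt ℝ ∞ (fun y => f y a) x) (hV : ∀ a, ContDiffAt ℝ ∞ (fun y => V y a) x)
    (hT : ∀ y ∈ U, ∀ a d, covDerivDiff g gbar k a d y = k y a * f y d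
      + V y a * lower (g y) (k y) d) (hfk : ∑ d, f x d * k x d = 0) (Z X : Coords n)
    (hZ : ∑ a, Z a * k x a = 0) (hX : ∑ a, lower (g x) (k x) a * X a = 0 ∨ V = 0) :
    ∑ a, ∑ c, ∑ d, Z a * k x c * X d *
      ∑ b, (riemannUp gbar a b c d x - riemannUp g a b c d x) * k x b = 0 := by
  obtain ⟨c, hc⟩ := h.geodetic x hx
  have hκ := h.sum_lower_self hx
  have hB : ∀ a d, covDeriv gbar k a d x = covDeriv g k a d x + (k x a * f x d
      + V x a * lower (g x) (k x) d) := by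
    intro a d; rw [← hT x hx, covDerivDiff]; ring
  have hBX : ∀ e, ∑ d, covDeriv gbar k e d x * X d = ∑ d, covDeriv g k e d x * X d
      + k x e * (∑ d, f x d * X d) + V x e * ∑ d, lower (g x) (k x) d * X d := by
    intro e
    rw [Finset.mul_sum, Finset.mul_sum, ← Finset.sum_add_distrib, ← Finset.sum_add_distrib]
    exact Finset.sum_congr rfl fun d _ => by rw [hB]; ring
  have hBk : ∀ e, ∑ d, covDeriv gbar k e d x * k x d = c * k x e := by
    intro e
    have h3 : ∑ b, k x b * covDeriv g k e b x = c * k x e := hc e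
    have : ∑ d, covDeriv gbar k e d x * k x d = ∑ b, k x b * covDeriv g k e b x
        + k x e * (∑ d, f x d * k x d) + V x e * ∑ d, lower (g x) (k x) d * k x d := by
      rw [Finset.mul_sum, Finset.mul_sum, ← Finset.sum_add_distrib, ← Finset.sum_add_distrib]
      exact Finset.sum_congr rfl fun d _ => by rw [hB]; ring
    rw [this, h3, hfk, hκ]; ring
  have hZT : ∀ w : Coords n, ∑ a, Z a * ∑ e, covDerivDiff g gbar k a e x * w e
      = (∑ a, Z a * V x a) * ∑ e, lower (g x) (k x) e * w e := by
    intro w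
    have : ∑ a, Z a * ∑ e, covDerivDiff g gbar k a e x * w e
        = (∑ a, Z a * k x a) * (∑ e, f x e * w e)
          + (∑ a, Z a * V x a) * ∑ e, lower (g x) (k x) e * w e := by
      rw [Finset.sum_mul, Finset.sum_mul, ← Finset.sum_add_distrib]
      refine Finset.sum_congr rfl fun a _ => ?_
      rw [mul_assoc, mul_assoc, ← mul_add]
      congr 1
      rw [Finset.mul_sum, Finset.mul_sum, ← Finset.sum_add_distrib]
      exact Finset.sum_congr rfl fun e _ => by rw [hT x hx]; ring
    rw [this, hZ]; ring
  have hκX : (∑ a, Z a * V x a) * ∑ e, lower (g x) (k x) e * X e = 0 := by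
    rcases hX with hX | hX
    · rw [hX, mul_zero]
    · simp [hX]
  have hlast : (∑ d, lower (g x) (k x) d * X d) * (∑ a, ∑ c, Z a * k x c * covDeriv g V a c x)
      = 0 := by
    rcases hX with hX | hX
    · rw [hX, zero_mul]
    · simp [hX, covDeriv, pd_const]
  -- the difference tensor applied to `k` and `∇̄_X k`, the latter being orthogonal to `k` when
  -- `X` is
  have hS1 : ∑ a, Z a * ∑ e, (∑ c, k x c * (christoffel gbar a c e x - christoffel g a c e x))
        * ∑ d, covDeriv gbar k e d x * X d = 0 := by
    simp only [h.sum_covDerivDiff hx]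
    rw [hZT]
    have : ∑ e, lower (g x) (k x) e * ∑ d, covDeriv gbar k e d x * X d
        = (∑ a, lower (g x) (k x) a * V x a) * ∑ d, lower (g x) (k x) d * X d := by
      have h1 : ∑ e, lower (g x) (k x) e * ∑ d, covDeriv g k e d x * X d = 0 := by
        simp only [Finset.mul_sum]
        rw [Finset.sum_comm]
        simp only [← mul_assoc, ← Finset.sum_mul, h.lower_covDeriv hx, zero_mul,
          Finset.sum_const_zero]
      simp only [hBX, mul_add, Finset.sum_add_distrib, h1, ← mul_assoc, ← Finset.sum_mul, hκ]
      ring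
    rw [this]
    linear_combination (∑ a, lower (g x) (k x) a * V x a) * hκX
  -- the difference tensor applied to `X` and `∇̄_k k`, the latter being proportional to `k` since
  -- `f_d kᵈ = 0`
  have hS2 : ∑ a, Z a * ∑ e, (∑ c, X c * (christoffel gbar a c e x - christoffel g a c e x))
        * ∑ d, covDeriv gbar k e d x * k x d = 0 := by
    have : ∀ a, ∑ e, (∑ c, X c * (christoffel gbar a c e x - christoffel g a c e x))
        * ∑ d, covDeriv gbar k e d x * k x d = c * ∑ e, covDerivDiff g gbar k a e x * X e := by
      intro a
      simp only [hBk, covDerivDiff_eq, Finset.sum_mul, Finset.mul_sum]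
      rw [Finset.sum_comm]
      exact Finset.sum_congr rfl fun e _ => Finset.sum_congr rfl fun b _ => by ring
    simp only [this, mul_left_comm (Z _), ← Finset.mul_sum, hZT, hκX, mul_zero]
  have hdκ : (∑ a, Z a * V x a) * ((∑ c, ∑ d, k x c * X d *
        pd c (fun y => lower (g y) (k y) d) x)
      - ∑ c, ∑ d, X c * k x d * pd c (fun y => lower (g y) (k y) d) x) = 0 := by
    have : (∑ c, ∑ d, k x c * X d * pd c (fun y => lower (g y) (k y) d) x)
        - ∑ c, ∑ d, X c * k x d * pd c (fun y => lower (g y) (k y) d) x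
        = c * ∑ e, lower (g x) (k x) e * X e := by
      rw [Finset.sum_comm, ← Finset.sum_sub_distrib, Finset.mul_sum]
      refine Finset.sum_congr rfl fun d _ => ?_
      rw [← Finset.sum_sub_distrib, ← mul_assoc, ← h.exterior_lower hx hc, Finset.sum_mul]
      exact Finset.sum_congr rfl fun b _ => by ring
    rw [this]
    linear_combination c * hκX
  have hmain := h.curvature_diff hx hf hV hT Z (k x) X
  simp only at hmain
  rw [hmain, hS1, hS2, hlast, hfk, hκ, sum_covDeriv_mul hc Z hZ, hZ]
  linear_combination hdκ

end CommonNullGeodetic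

/-! ### Kerr–Schild pairs of metrics -/

namespace IsMetricOn

variable {U : Set (Coords n)} {g : MetricField n} (hg : IsMetricOn U g) {x : Coords n} (hx : x ∈ U)

include hg hx

/-- Every covector is obtained from a vector by lowering its index. -/
theorem exists_lower_eq (Z : Coords n) : ∃ z : Coords n, ∀ a, Z a = ∑ d, z d * g x d a := by
  refine ⟨fun d => ∑ b, Z b * (g x)⁻¹ b d, fun a => ?_⟩
  simp only [Finset.sum_mul]
  rw [Finset.sum_comm]
  simp only [mul_assoc, ← Finset.mul_sum, hg.inv_sum hx]
  simp

theorem raise_lower (v F : Coords n) (hF : ∀ d, ∑ a, g x d a * v a = F d) (a : Fin n) :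
    v a = ∑ d, (g x)⁻¹ a d * F d := by
  simp only [← hF, Finset.mul_sum, ← mul_assoc]
  rw [Finset.sum_comm]
  simp only [← Finset.sum_mul, hg.inv_sum hx]
  simp

end IsMetricOn

namespace CommonNullGeodetic

variable {U : Set (Coords n)} {g gbar : MetricField n} {k : Coords n → Coords n}
  (h : CommonNullGeodetic U g gbar k) {x : Coords n} (hx : x ∈ U)

include h hx

/-- When `∇̄_b kᵃ - ∇_b kᵃ = kᵃ f_b` and the difference tensor of the connections maps pairs of
vectors orthogonal to `k` to multiples of `k`, the curvatures of the two metrics have the same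
components `Z_a Rᵃ_{bcd} kᵇ Xᶜ Yᵈ` for `Z`, `X`, `Y` orthogonal to `k`. -/
theorem curvature_diff_transverse {f : Coords n → Coords n}
    (hf : ∀ a, ContDiffAt ℝ ∞ (fun y => f y a) x)
    (hT : ∀ y ∈ U, ∀ a d, covDerivDiff g gbar k a d y = k y a * f y d)
    (Z X Y : Coords n) (hZ : ∑ a, Z a * k x a = 0)
    (hX : ∑ a, lower (g x) (k x) a * X a = 0) (hY : ∑ a, lower (g x) (k x) a * Y a = 0)
    (hfX : ∑ a, f x a * X a = 0) (hfY : ∑ a, f x a * Y a = 0)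
    (hS : ∀ X Y : Coords n, ∑ a, lower (g x) (k x) a * X a = 0 →
      ∑ a, lower (g x) (k x) a * Y a = 0 → ∑ a, Z a * ∑ e,
        (∑ c, X c * (christoffel gbar a c e x - christoffel g a c e x)) * Y e = 0) :
    ∑ a, ∑ c, ∑ d, Z a * X c * Y d *
      ∑ b, (riemannUp gbar a b c d x - riemannUp g a b c d x) * k x b = 0 := by
  have hB : ∀ Y : Coords n, ∑ a, f x a * Y a = 0 →
      ∑ e, lower (g x) (k x) e * ∑ d, covDeriv gbar k e d x * Y d = 0 := by
    intro Y hfY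
    have h1 : ∀ e, ∑ d, covDeriv gbar k e d x * Y d = ∑ d, covDeriv g k e d x * Y d := by
      intro e
      have : ∑ d, covDeriv gbar k e d x * Y d = ∑ d, covDeriv g k e d x * Y d
          + k x e * ∑ a, f x a * Y a := by
        rw [Finset.mul_sum, ← Finset.sum_add_distrib]
        refine Finset.sum_congr rfl fun d _ => ?_
        have := hT x hx e d
        rw [covDerivDiff] at this
        linear_combination Y d * this
      rw [this, hfY]; ring
    simp only [h1, Finset.mul_sum]
    rw [Finset.sum_comm]
    simp only [← mul_assoc, ← Finset.sum_mul, h.lower_covDeriv hx, zero_mul,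
      Finset.sum_const_zero]
  have hmain := h.curvature_diff hx (V := fun _ _ => 0) hf (fun _ => contDiffAt_const)
    (fun y hy a d => by rw [hT y hy]; ring) Z X Y
  simp only at hmain
  rw [hmain, hfX, hfY, hX, hY, hZ, hS X _ hX (hB Y hfY), hS Y _ hY (hB X hfX)]
  simp

/-- The Lie derivative of `k_a` along `k` is proportional to `k_a`. -/
theorem lie_lower {c : ℝ} (hc : ∀ a, acceleration g k a x = c * k x a) (d : Fin n) :
    ∑ e, k x e * pd e (fun y => lower (g y) (k y) d) x
      + ∑ e, lower (g x) (k x) e * pd d (fun y => k y e) x = c * lower (g x) (k x) d := by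
  rw [← h.exterior_lower hx hc, h.pd_lower_mul hx]
  simp only [mul_sub, Finset.sum_sub_distrib]
  simp only [mul_comm (k x _)]
  ring

/-- The tensor `∇̄_b kᵃ - ∇_b kᵃ` for `gbar = g + 2 H k_a k_b + K (k_a μ_b + k_b μ_a)`. -/
theorem lower_covDerivDiff_kerrSchild {H K : Coords n → ℝ} {μ : Coords n → Coords n}
    (hH : ContDiffAt ℝ ∞ H x) (hK : ContDiffAt ℝ ∞ K x)
    (hμ : ∀ a, ContDiffAt ℝ ∞ (fun y => μ y a) x)
    (hg : ∀ y ∈ U, ∀ a b, gbar y a b - g y a b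
      = 2 * H y * lower (g y) (k y) a * lower (g y) (k y) b
        + K y * (lower (g y) (k y) a * μ y b + lower (g y) (k y) b * μ y a))
    {c : ℝ} (hc : ∀ a, acceleration g k a x = c * k x a) (p q : Fin n) :
    2 * ∑ a, gbar x p a * covDerivDiff g gbar k a q x =
      2 * (∑ e, k x e * pd e H x + 2 * c * H x) * lower (g x) (k x) p * lower (g x) (k x) q
      + (∑ e, k x e * pd e K x + c * K x) * (lower (g x) (k x) p * μ x q
        + lower (g x) (k x) q * μ x p)
      + K x * (lower (g x) (k x) p * (∑ e, k x e * pd e (fun y => μ y q) x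
          + ∑ e, μ x e * pd q (fun y => k y e) x)
        + lower (g x) (k x) q * (∑ e, k x e * pd e (fun y => μ y p) x
          + ∑ e, μ x e * pd p (fun y => k y e) x))
      - 2 * K x * lower (g x) (k x) p * ∑ a, μ x a * covDeriv g k a q x := by
  have hl := fun a => diffAt (h.contDiffAt_lower hx a)
  have hm := fun a => diffAt (hμ a)
  have hH' := diffAt hH
  have hK' := diffAt hK
  rw [h.lower_covDerivDiff hx]
  have e1 : ∀ e, pd e (fun y => gbar y p q - g y p q) x
      = 2 * pd e H x * lower (g x) (k x) p * lower (g x) (k x) q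
        + 2 * H x * pd e (fun y => lower (g y) (k y) p) x * lower (g x) (k x) q
        + 2 * H x * lower (g x) (k x) p * pd e (fun y => lower (g y) (k y) q) x
        + pd e K x * (lower (g x) (k x) p * μ x q + lower (g x) (k x) q * μ x p)
        + K x * (pd e (fun y => lower (g y) (k y) p) x * μ x q
          + lower (g x) (k x) p * pd e (fun y => μ y q) x
          + pd e (fun y => lower (g y) (k y) q) x * μ x p
          + lower (g x) (k x) q * pd e (fun y => μ y p) x) := by
    intro e
    rw [eqOn_pd h.metric.isOpen (fun y hy => hg y hy p q) e hx,
      pd_add (((hH'.const_mul 2).fun_mul (hl p)).fun_mul (hl q)) (hK'.fun_mul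
        (((hl p).fun_mul (hm q)).fun_add ((hl q).fun_mul (hm p)))),
      pd_mul ((hH'.const_mul 2).fun_mul (hl p)) (hl q), pd_mul (hH'.const_mul 2) (hl p),
      pd_mul (differentiableAt_const _) hH', pd_const,
      pd_mul hK' (((hl p).fun_mul (hm q)).fun_add ((hl q).fun_mul (hm p))),
      pd_add ((hl p).fun_mul (hm q)) ((hl q).fun_mul (hm p)), pd_mul (hl p) (hm q),
      pd_mul (hl q) (hm p)]
    ring
  have e2 : ∀ (p : Fin n) (F : Coords n), ∑ a, (gbar x p a - g x p a) * F a
      = (2 * H x * lower (g x) (k x) p + K x * μ x p) * (∑ a, lower (g x) (k x) a * F a)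
        + K x * lower (g x) (k x) p * ∑ a, μ x a * F a := by
    intro p F
    rw [Finset.mul_sum, Finset.mul_sum, ← Finset.sum_add_distrib]
    refine Finset.sum_congr rfl fun a _ => ?_
    rw [hg x hx]; ring
  have e3 : ∑ e, k x e * pd e (fun y => gbar y p q - g y p q) x
      = 2 * (∑ e, k x e * pd e H x) * lower (g x) (k x) p * lower (g x) (k x) q
        + 2 * H x * (∑ e, k x e * pd e (fun y => lower (g y) (k y) p) x) * lower (g x) (k x) q
        + 2 * H x * lower (g x) (k x) p * (∑ e, k x e * pd e (fun y => lower (g y) (k y) q) x)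
        + (∑ e, k x e * pd e K x) * (lower (g x) (k x) p * μ x q + lower (g x) (k x) q * μ x p)
        + K x * ((∑ e, k x e * pd e (fun y => lower (g y) (k y) p) x) * μ x q
          + lower (g x) (k x) p * (∑ e, k x e * pd e (fun y => μ y q) x)
          + (∑ e, k x e * pd e (fun y => lower (g y) (k y) q) x) * μ x p
          + lower (g x) (k x) q * (∑ e, k x e * pd e (fun y => μ y p) x)) := by
    simp only [e1, Finset.mul_sum, Finset.sum_mul, ← Finset.sum_add_distrib]
    exact Finset.sum_congr rfl fun e _ => by ring
  rw [e3, e2 p (fun a => pd q (fun y => k y a) x), e2 q (fun a => pd p (fun y => k y a) x),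
    e2 p (fun a => covDeriv g k a q x), h.lower_covDeriv hx]
  have hp := h.lie_lower hx hc p
  have hq := h.lie_lower hx hc q
  linear_combination (2 * H x * lower (g x) (k x) q + K x * μ x q) * hp
    + (2 * H x * lower (g x) (k x) p + K x * μ x p) * hq

/-- The algebraic structure of `∇̄_b kᵃ - ∇_b kᵃ` for an extended Kerr–Schild pair. -/
theorem covDerivDiff_extended {H K : Coords n → ℝ} {μ : Coords n → Coords n}
    (hH : ContDiffAt ℝ ∞ H x) (hK : ContDiffAt ℝ ∞ K x)
    (hμ : ∀ a, ContDiffAt ℝ ∞ (fun y => μ y a) x) (hμk : ∀ y ∈ U, ∑ a, μ y a * k y a = 0)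
    (hg : ∀ y ∈ U, ∀ a b, gbar y a b - g y a b
      = 2 * H y * lower (g y) (k y) a * lower (g y) (k y) b
        + K y * (lower (g y) (k y) a * μ y b + lower (g y) (k y) b * μ y a)) :
    ∃ φ W : Coords n, (∀ a d, covDerivDiff g gbar k a d x
      = k x a * φ d + W a * lower (g x) (k x) d) ∧ ∑ d, φ d * k x d = 0 := by
  obtain ⟨c, hc⟩ := h.geodetic x hx
  have hk := fun a => diffAt (h.smooth x hx a)
  have hm := fun a => diffAt (hμ a)
  -- the Lie derivative of `μ_a` along `k`
  obtain ⟨w, hw⟩ : ∃ w : Coords n, ∀ d, w d = ∑ e, k x e * pd e (fun y => μ y d) x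
          + ∑ e, μ x e * pd d (fun y => k y e) x := ⟨_, fun _ => rfl⟩
  obtain ⟨β, hβ⟩ : ∃ β : Coords n, ∀ d, β d = ∑ a, μ x a * covDeriv g k a d x :=
    ⟨_, fun _ => rfl⟩
  obtain ⟨s, hs⟩ : ∃ s, s = ∑ e, k x e * pd e K x + c * K x := ⟨_, rfl⟩
  obtain ⟨t, ht⟩ : ∃ t, t = ∑ e, k x e * pd e H x + 2 * c * H x := ⟨_, rfl⟩
  have hwk : ∑ d, w d * k x d = 0 := by
    have h0 : ∀ e, ∑ d, (pd e (fun y => μ y d) x * k x d + μ x d * pd e (fun y => k y d) x)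
        = 0 := by
      intro e
      simp only [← pd_mul (hm _) (hk _)]
      rw [← pd_sum _ fun a => (hm a).fun_mul (hk a), ← pd_const 0 e x]
      exact eqOn_pd h.metric.isOpen (fun y hy => hμk y hy) e hx
    have h1 : ∑ d, w d * k x d = ∑ e, k x e * ∑ d, (pd e (fun y => μ y d) x * k x d
        + μ x d * pd e (fun y => k y d) x) := by
      simp only [hw, add_mul, Finset.sum_add_distrib, mul_add, Finset.sum_mul, Finset.mul_sum]
      congr 1
      · rw [Finset.sum_comm]
        exact Finset.sum_congr rfl fun _ _ => Finset.sum_congr rfl fun _ _ => by ring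
      · exact Finset.sum_congr rfl fun _ _ => Finset.sum_congr rfl fun _ _ => by ring
    simp only [h1, h0, mul_zero, Finset.sum_const_zero]
  have hβk : ∑ d, β d * k x d = 0 := by
    rw [← sum_covDeriv_mul hc (μ x) (hμk x hx)]
    simp only [hβ, Finset.sum_mul, Finset.mul_sum]
    rw [Finset.sum_comm]
    exact Finset.sum_congr rfl fun _ _ => Finset.sum_congr rfl fun _ _ => by ring
  refine ⟨fun d => t * lower (g x) (k x) d + s / 2 * μ x d + K x / 2 * w d - K x * β d,
    fun a => ∑ d, (gbar x)⁻¹ a d * (s / 2 * μ x d + K x / 2 * w d), fun a q => ?_, ?_⟩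
  · rw [h.background.raise_lower hx (k x) _ (fun d => h.lower_eq x hx d) a,
      h.background.raise_lower hx (fun a => covDerivDiff g gbar k a q x) _ (fun d => rfl) a,
      Finset.sum_mul, Finset.sum_mul, ← Finset.sum_add_distrib]
    refine Finset.sum_congr rfl fun p _ => ?_
    have := h.lower_covDerivDiff_kerrSchild hx hH hK hμ hg hc p q
    rw [← hw, ← hw, ← hβ, ← hs, ← ht] at this
    linear_combination (gbar x)⁻¹ a p / 2 * this
  · have h1 : ∑ d, (t * lower (g x) (k x) d + s / 2 * μ x d + K x / 2 * w d - K x * β d) * k x d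
        = t * (∑ d, lower (g x) (k x) d * k x d) + s / 2 * (∑ d, μ x d * k x d)
          + K x / 2 * (∑ d, w d * k x d) - K x * ∑ d, β d * k x d := by
      simp only [Finset.mul_sum, ← Finset.sum_add_distrib, ← Finset.sum_sub_distrib]
      exact Finset.sum_congr rfl fun d _ => by ring
    rw [h1, h.sum_lower_self hx, hμk x hx, hwk, hβk]; ring

/-- For a generalized Kerr–Schild pair, `∇̄_b kᵃ - ∇_b kᵃ` is a multiple of `kᵃ k_b`. -/
theorem covDerivDiff_generalized {H : Coords n → ℝ} (hH : ContDiffAt ℝ ∞ H x)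
    (hg : ∀ y ∈ U, ∀ a b, gbar y a b - g y a b
      = 2 * H y * lower (g y) (k y) a * lower (g y) (k y) b) :
    ∃ t : ℝ, ∀ a d, covDerivDiff g gbar k a d x = k x a * (t * lower (g x) (k x) d) := by
  obtain ⟨c, hc⟩ := h.geodetic x hx
  refine ⟨∑ e, k x e * pd e H x + 2 * c * H x, fun a q => ?_⟩
  rw [h.background.raise_lower hx (k x) _ (fun d => h.lower_eq x hx d) a,
    h.background.raise_lower hx (fun a => covDerivDiff g gbar k a q x) _ (fun d => rfl) a,
    Finset.sum_mul]
  refine Finset.sum_congr rfl fun p _ => ?_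
  have := h.lower_covDerivDiff_kerrSchild hx (K := fun _ => 0) (μ := fun _ _ => 0) hH
    contDiffAt_const (fun _ => contDiffAt_const) (fun y hy a b => by rw [hg y hy]; ring) hc p q
  simp only [pd_const, mul_zero, zero_mul, add_zero, sub_zero, Finset.sum_const_zero] at this
  linear_combination (gbar x)⁻¹ a p / 2 * this

/-- For a generalized Kerr–Schild pair, the difference tensor of the connections maps two vectors
orthogonal to `k` to a multiple of `k`. -/
theorem christoffel_diff_generalized {H : Coords n → ℝ} (hH : ContDiffAt ℝ ∞ H x)
    (hg : ∀ y ∈ U, ∀ a b, gbar y a b - g y a b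
      = 2 * H y * lower (g y) (k y) a * lower (g y) (k y) b) (Z X Y : Coords n)
    (hZ : ∑ a, Z a * k x a = 0) (hX : ∑ a, lower (g x) (k x) a * X a = 0)
    (hY : ∑ a, lower (g x) (k x) a * Y a = 0) :
    ∑ a, Z a * ∑ e, (∑ c, X c * (christoffel gbar a c e x - christoffel g a c e x)) * Y e
      = 0 := by
  have hl := fun a => diffAt (h.contDiffAt_lower hx a)
  have hH' := diffAt hH
  obtain ⟨z, hz⟩ := h.background.exists_lower_eq hx Z
  obtain ⟨κ, hκ⟩ : ∃ κ : Coords n, ∀ a, κ a = lower (g x) (k x) a := ⟨_, fun _ => rfl⟩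
  simp only [← hκ] at hX hY
  have hzκ : ∑ a, κ a * z a = 0 := by
    have hκ' : ∀ a, κ a = lower (gbar x) (k x) a := fun a => by rw [hκ, h.lower_eq x hx]
    rw [← hZ]
    simp only [hκ', hz, lower, Finset.sum_mul]
    rw [Finset.sum_comm]
    exact Finset.sum_congr rfl fun _ _ => Finset.sum_congr rfl fun _ _ => by ring
  obtain ⟨α, hα⟩ : ∃ α : Fin n → Fin n → ℝ, ∀ b d, α b d = 2 * pd b H x * κ d
      + 2 * H x * pd b (fun y => lower (g y) (k y) d) x := ⟨_, fun _ _ => rfl⟩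
  obtain ⟨γ, hγ⟩ : ∃ γ : Fin n → Fin n → ℝ, ∀ b d, γ b d
      = 2 * H x * pd b (fun y => lower (g y) (k y) d) x := ⟨_, fun _ _ => rfl⟩
  have hpd : ∀ b d c, pd b (fun y => gbar y d c) x - pd b (fun y => g y d c) x
      = α b d * κ c + κ d * γ b c := by
    intro b d c
    rw [← pd_sub (h.background.diff hx _ _) (h.metric.diff hx _ _),
      eqOn_pd h.metric.isOpen (fun y hy => hg y hy d c) b hx,
      pd_mul ((hH'.const_mul 2).fun_mul (hl d)) (hl c), pd_mul (hH'.const_mul 2) (hl d),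
      pd_mul (differentiableAt_const _) hH', pd_const, hα, hγ, hκ, hκ]
    ring
  have hs : ∀ d b c, ∑ a, gbar x d a * (christoffel gbar a b c x - christoffel g a b c x)
      = κ d * ((γ b c + γ c b) / 2 - 2 * H x * ∑ a, κ a * christoffel g a b c x)
        + κ b * ((α c d - γ d c) / 2) + κ c * ((α b d - α d b) / 2) := by
    intro d b c
    have h1 : ∑ a, gbar x d a * (christoffel gbar a b c x - christoffel g a b c x)
        = ∑ a, gbar x d a * christoffel gbar a b c x - ∑ a, g x d a * christoffel g a b c x
          - 2 * H x * κ d * ∑ a, κ a * christoffel g a b c x := by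
      rw [Finset.mul_sum, ← Finset.sum_sub_distrib, ← Finset.sum_sub_distrib]
      refine Finset.sum_congr rfl fun a _ => ?_
      have := hg x hx d a
      rw [← hκ, ← hκ] at this
      linear_combination (-christoffel g a b c x) * this
    rw [h1, h.background.lower_christoffel hx, h.metric.lower_christoffel hx]
    unfold christoffelDown
    linear_combination (1 / 2) * hpd b d c + (1 / 2) * hpd c d b - (1 / 2) * hpd d b c
  have hE : ∑ a, Z a * ∑ e, (∑ c, X c * (christoffel gbar a c e x - christoffel g a c e x)) * Y e
      = ∑ d, ∑ c, ∑ e, z d * X c * Y e *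
        ∑ a, gbar x d a * (christoffel gbar a c e x - christoffel g a c e x) := by
    have h1 : ∀ a, ∑ e, (∑ c, X c * (christoffel gbar a c e x - christoffel g a c e x)) * Y e
        = ∑ c, ∑ e, X c * Y e * (christoffel gbar a c e x - christoffel g a c e x) := by
      intro a
      simp only [Finset.sum_mul]
      rw [Finset.sum_comm]
      exact Finset.sum_congr rfl fun _ _ => Finset.sum_congr rfl fun _ _ => by ring
    simp only [h1]
    simp only [hz, Finset.sum_mul]
    rw [Finset.sum_comm]
    refine Finset.sum_congr rfl fun d _ => ?_
    simp only [Finset.mul_sum]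
    rw [Finset.sum_comm]
    refine Finset.sum_congr rfl fun c _ => ?_
    rw [Finset.sum_comm]
    exact Finset.sum_congr rfl fun _ _ => Finset.sum_congr rfl fun _ _ => by ring
  rw [hE]
  simp only [hs, mul_add, Finset.sum_add_distrib]
  have t1 : ∀ A : Fin n → Fin n → ℝ, ∑ d, ∑ c, ∑ e, z d * X c * Y e * (κ d * A c e) = 0 := by
    intro A
    have : ∀ d, ∑ c, ∑ e, z d * X c * Y e * (κ d * A c e)
        = κ d * z d * ∑ c, ∑ e, X c * Y e * A c e := by
      intro d
      simp only [Finset.mul_sum]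
      exact Finset.sum_congr rfl fun _ _ => Finset.sum_congr rfl fun _ _ => by ring
    simp only [this, ← Finset.sum_mul, hzκ, zero_mul]
  have t2 : ∀ A : Fin n → Fin n → ℝ, ∑ d, ∑ c, ∑ e, z d * X c * Y e * (κ c * A d e) = 0 := by
    intro A
    refine Finset.sum_eq_zero fun d _ => ?_
    have : ∀ c, ∑ e, z d * X c * Y e * (κ c * A d e)
        = κ c * X c * ∑ e, z d * Y e * A d e := by
      intro c
      simp only [Finset.mul_sum]
      exact Finset.sum_congr rfl fun _ _ => by ring
    simp only [this, ← Finset.sum_mul, hX, zero_mul]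
  have t3 : ∀ A : Fin n → Fin n → ℝ, ∑ d, ∑ c, ∑ e, z d * X c * Y e * (κ e * A d c) = 0 := by
    intro A
    refine Finset.sum_eq_zero fun d _ => Finset.sum_eq_zero fun c _ => ?_
    have : ∀ e, z d * X c * Y e * (κ e * A d c) = κ e * Y e * (z d * X c * A d c) := by
      intro e; ring
    simp only [this, ← Finset.sum_mul, hY, zero_mul]
  rw [t1 (fun b c => (γ b c + γ c b) / 2 - 2 * H x * ∑ a, κ a * christoffel g a b c x),
    t2 (fun d c => (α c d - γ d c) / 2), t3 (fun d b => (α b d - α d b) / 2)]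
  ring

end CommonNullGeodetic

/-! ### Ricci components, null frames and aligned null directions -/

/-- The contraction `Z_a Rᵃ_{bcd} qᵇ pᶜ Xᵈ` with a covector `Z`. -/
noncomputable def riemannUpOn (g : MetricField n) (x Z q p X : Coords n) : ℝ :=
  ∑ a, ∑ c, ∑ d, Z a * p c * X d * ∑ b, riemannUp g a b c d x * q b

/-- The contraction `R_{abcd} pᵃ qᵇ rᶜ sᵈ`. -/
noncomputable def riemannOn (g : MetricField n) (x p q r s : Coords n) : ℝ :=
  ∑ a, ∑ b, ∑ c, ∑ d, riemann g a b c d x * p a * q b * r c * s d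

/-- The contraction `R_{ab} pᵃ qᵇ` of the Ricci tensor. -/
noncomputable def ricciOn (g : MetricField n) (x p q : Coords n) : ℝ :=
  ∑ a, ∑ b, ricci g a b x * p a * q b

theorem riemannUpOn_antisymm (g : MetricField n) (x Z q p X : Coords n) :
    riemannUpOn g x Z q p X = -riemannUpOn g x Z q X p := by
  simp only [riemannUpOn, ← Finset.sum_neg_distrib]
  refine Finset.sum_congr rfl fun a _ => ?_
  rw [Finset.sum_comm]
  refine Finset.sum_congr rfl fun d _ => Finset.sum_congr rfl fun c _ => ?_
  rw [← mul_neg, ← Finset.sum_neg_distrib]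
  simp only [fun b => IsMetricOn.riemannUp_antisymm g a b c d x, neg_mul]
  ring

/-- The Weyl tensor on four vectors, split into its Riemann, Ricci and scalar curvature parts. -/
theorem weylOn_eq (g : MetricField n) (x p q r s : Coords n) : weylOn g x p q r s =
    riemannOn g x p q r s - 1 / ((n : ℝ) - 2) *
      ((ip (g x) p r * ricciOn g x s q - ip (g x) p s * ricciOn g x r q)
        - (ip (g x) q r * ricciOn g x s p - ip (g x) q s * ricciOn g x r p))
    + 1 / (((n : ℝ) - 1) * ((n : ℝ) - 2)) * scalarCurvature g x *
      (ip (g x) p r * ip (g x) s q - ip (g x) p s * ip (g x) r q) := by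
  have h1 : ∀ (A B : Fin n → Fin n → ℝ) (p q r s : Coords n),
      ∑ a, ∑ b, ∑ c, ∑ d, (A a c * B d b) * p a * q b * r c * s d
        = (∑ a, ∑ c, A a c * p a * r c) * (∑ d, ∑ b, B d b * s d * q b) := by
    intro A B p q r s
    rw [Finset.sum_mul]
    refine Finset.sum_congr rfl fun a _ => ?_
    rw [Finset.sum_comm, Finset.sum_mul]
    refine Finset.sum_congr rfl fun c _ => ?_
    rw [Finset.sum_comm, Finset.mul_sum]
    refine Finset.sum_congr rfl fun d _ => ?_
    rw [Finset.mul_sum]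
    exact Finset.sum_congr rfl fun b _ => by ring
  have h2 : ∀ (A B : Fin n → Fin n → ℝ) (p q r s : Coords n),
      ∑ a, ∑ b, ∑ c, ∑ d, (A a d * B c b) * p a * q b * r c * s d
        = (∑ a, ∑ d, A a d * p a * s d) * (∑ c, ∑ b, B c b * r c * q b) := by
    intro A B p q r s
    rw [← h1]
    refine Finset.sum_congr rfl fun a _ => Finset.sum_congr rfl fun b _ => ?_
    rw [Finset.sum_comm]
    exact Finset.sum_congr rfl fun d _ => Finset.sum_congr rfl fun c _ => by ring
  have h3 : ∀ (A B : Fin n → Fin n → ℝ) (p q r s : Coords n),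
      ∑ a, ∑ b, ∑ c, ∑ d, (A b c * B d a) * p a * q b * r c * s d
        = (∑ b, ∑ c, A b c * q b * r c) * (∑ d, ∑ a, B d a * s d * p a) := by
    intro A B p q r s
    rw [← h1, Finset.sum_comm]
    exact Finset.sum_congr rfl fun b _ => Finset.sum_congr rfl fun a _ =>
      Finset.sum_congr rfl fun c _ => Finset.sum_congr rfl fun d _ => by ring
  have h4 : ∀ (A B : Fin n → Fin n → ℝ) (p q r s : Coords n),
      ∑ a, ∑ b, ∑ c, ∑ d, (A b d * B c a) * p a * q b * r c * s d
        = (∑ b, ∑ d, A b d * q b * s d) * (∑ c, ∑ a, B c a * r c * p a) := by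
    intro A B p q r s
    rw [← h2, Finset.sum_comm]
    exact Finset.sum_congr rfl fun b _ => Finset.sum_congr rfl fun a _ =>
      Finset.sum_congr rfl fun c _ => Finset.sum_congr rfl fun d _ => by ring
  have e : ∀ a b c d, weyl g a b c d x * p a * q b * r c * s d =
      riemann g a b c d x * p a * q b * r c * s d - 1 / ((n : ℝ) - 2) *
      (((g x a c * ricci g d b x) * p a * q b * r c * s d
        - (g x a d * ricci g c b x) * p a * q b * r c * s d)
        - ((g x b c * ricci g d a x) * p a * q b * r c * s d
        - (g x b d * ricci g c a x) * p a * q b * r c * s d))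
    + 1 / (((n : ℝ) - 1) * ((n : ℝ) - 2)) * scalarCurvature g x *
      ((g x a c * g x d b) * p a * q b * r c * s d
        - (g x a d * g x c b) * p a * q b * r c * s d) := by
    intro a b c d; rw [weyl]; ring
  simp only [weylOn, e, Finset.sum_add_distrib, Finset.sum_sub_distrib, ← Finset.mul_sum]
  rw [h1 (fun a c => g x a c) (fun d b => ricci g d b x),
    h2 (fun a d => g x a d) (fun c b => ricci g c b x),
    h3 (fun b c => g x b c) (fun d a => ricci g d a x),
    h4 (fun b d => g x b d) (fun c a => ricci g c a x),
    h1 (fun a c => g x a c) (fun d b => g x d b), h2 (fun a d => g x a d) (fun c b => g x c b)]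
  rfl

namespace IsMetricOn

variable {U : Set (Coords n)} {g : MetricField n} (hg : IsMetricOn U g) {x : Coords n} (hx : x ∈ U)

include hg hx

theorem ip_comm (v w : Coords n) : ip (g x) v w = ip (g x) w v := by
  simp only [ip]
  rw [Finset.sum_comm]
  refine Finset.sum_congr rfl fun a _ => Finset.sum_congr rfl fun b _ => ?_
  rw [hg.symm x hx b a]; ring

theorem riemannOn_eq (p q r s : Coords n) :
    riemannOn g x p q r s = riemannUpOn g x (lower (g x) p) q r s := by
  have h1 : ∀ a, ∑ b, ∑ c, ∑ d, riemann g a b c d x * p a * q b * r c * s d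
      = ∑ e, g x a e * p a * ∑ c, ∑ d, r c * s d * ∑ b, riemannUp g e b c d x * q b := by
    intro a
    simp only [riemann, Finset.mul_sum, Finset.sum_mul]
    rw [Finset.sum_comm]
    refine (Finset.sum_congr rfl fun c _ => Finset.sum_comm).trans ?_
    refine (Finset.sum_congr rfl fun c _ => Finset.sum_congr rfl fun d _ =>
      Finset.sum_comm).trans ?_
    refine (Finset.sum_congr rfl fun c _ => Finset.sum_comm).trans ?_
    rw [Finset.sum_comm]
    exact Finset.sum_congr rfl fun _ _ => Finset.sum_congr rfl fun _ _ =>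
      Finset.sum_congr rfl fun _ _ => Finset.sum_congr rfl fun _ _ => by ring
  simp only [riemannOn, h1]
  rw [Finset.sum_comm]
  simp only [← Finset.sum_mul, riemannUpOn]
  refine Finset.sum_congr rfl fun e _ => ?_
  have : ∑ a, g x a e * p a = lower (g x) p e :=
    Finset.sum_congr rfl fun a _ => by rw [hg.symm x hx]
  rw [this]
  simp only [Finset.mul_sum]
  exact Finset.sum_congr rfl fun _ _ => Finset.sum_congr rfl fun _ _ =>
      Finset.sum_congr rfl fun _ _ => by ring

theorem riemannOn_antisymm (p q r s : Coords n) :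
    riemannOn g x p q r s = -riemannOn g x q p r s := by
  simp only [riemannOn, ← Finset.sum_neg_distrib]
  rw [Finset.sum_comm]
  refine Finset.sum_congr rfl fun a _ => Finset.sum_congr rfl fun b _ =>
    Finset.sum_congr rfl fun c _ => Finset.sum_congr rfl fun d _ => ?_
  rw [hg.riemann_antisymm hx]; ring

theorem riemannOn_pair (p q r s : Coords n) :
    riemannOn g x p q r s = riemannOn g x r s p q := by
  simp only [riemannOn]
  refine (Finset.sum_congr rfl fun a _ => Finset.sum_comm).trans ?_
  rw [Finset.sum_comm]
  refine Finset.sum_congr rfl fun c _ => ?_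
  refine (Finset.sum_congr rfl fun a _ => Finset.sum_comm).trans ?_
  rw [Finset.sum_comm]
  refine Finset.sum_congr rfl fun d _ => Finset.sum_congr rfl fun a _ =>
    Finset.sum_congr rfl fun b _ => ?_
  rw [hg.riemann_pair hx a b]; ring

theorem riemannUp_eq_inv (a b c d : Fin n) :
    riemannUp g a b c d x = ∑ e, (g x)⁻¹ a e * riemann g e b c d x :=
  hg.raise_lower hx (fun e => riemannUp g e b c d x) _ (fun _ => rfl) a

theorem ricci_symm (a b : Fin n) : ricci g a b x = ricci g b a x := by
  have hgT : (g x)ᵀ = g x := Matrix.ext fun i j => hg.symm x hx j i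
  have hinv : ∀ c e, (g x)⁻¹ c e = (g x)⁻¹ e c := by
    intro c e
    have := congrFun (congrFun (Matrix.transpose_nonsing_inv (g x)) e) c
    rw [hgT] at this
    exact this
  simp only [ricci, hg.riemannUp_eq_inv hx]
  rw [Finset.sum_comm]
  refine Finset.sum_congr rfl fun c _ => Finset.sum_congr rfl fun e _ => ?_
  rw [hinv, hg.riemann_pair hx c a]

theorem ricciOn_symm (p q : Coords n) : ricciOn g x p q = ricciOn g x q p := by
  simp only [ricciOn]
  rw [Finset.sum_comm]
  refine Finset.sum_congr rfl fun a _ => Finset.sum_congr rfl fun b _ => ?_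
  rw [hg.ricci_symm hx]; ring

/-- `R_{ab} kᵃ qᵇ` vanishes for a null vector `k` when the curvature operator whose trace it is
acts trivially on the space orthogonal to `k` modulo `k`. -/
theorem ricciOn_eq_zero {k q : Coords n} (hk : k ≠ 0) (hnull : ip (g x) k k = 0)
    (hA : ∀ Z X : Coords n, ∑ a, Z a * k a = 0 → ∑ a, lower (g x) k a * X a = 0 →
      riemannUpOn g x Z k X q = 0)
    (hB : ∀ Z, riemannUpOn g x Z k k q = 0) : ricciOn g x k q = 0 := by
  have hM : ∀ Z X : Coords n, ∑ a, ∑ d, Z a * X d * ∑ b, q b * ∑ e, riemannUp g a e d b x * k e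
      = riemannUpOn g x Z k X q := by
    intro Z X
    simp only [riemannUpOn]
    refine Finset.sum_congr rfl fun a _ => Finset.sum_congr rfl fun d _ => ?_
    rw [Finset.mul_sum]
    exact Finset.sum_congr rfl fun b _ => by ring
  have hκ : lower (g x) k ≠ 0 := fun h0 => hk
    (Matrix.eq_zero_of_mulVec_eq_zero (hg.det x hx) (funext fun a => congrFun h0 a))
  have htr := trace_eq_zero_of_quotient
    (M := fun a d => ∑ b, q b * ∑ e, riemannUp g a e d b x * k e) hk hκ
    (by rw [sum_lower_mul]; exact hnull)
    (fun a => by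
      have := hB (Pi.single a 1)
      rw [← hM, Finset.sum_eq_single a (fun b _ hb => by simp [hb]) (by simp)] at this
      rw [← this]
      exact Finset.sum_congr rfl fun d _ => by simp [mul_comm])
    (fun d => by
      have h1 : riemannOn g x k k (Pi.single d 1) q = 0 := by
        have := hg.riemannOn_antisymm hx k k (Pi.single d 1) q
        linarith
      rw [hg.riemannOn_eq hx, ← hM] at h1
      rw [← h1]
      refine Finset.sum_congr rfl fun a _ => ?_
      refine Eq.trans ?_ (Finset.sum_eq_single d (fun b _ hb => by simp [hb]) (by simp)).symm
      simp)
    (fun Z X hZ hX => by rw [hM]; exact hA Z X hZ hX)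
  rw [← htr]
  simp only [ricciOn, ricci, Finset.sum_mul, Finset.mul_sum]
  refine (Finset.sum_congr rfl fun a _ => Finset.sum_comm).trans ?_
  rw [Finset.sum_comm]
  refine Finset.sum_congr rfl fun c _ => ?_
  rw [Finset.sum_comm]
  exact Finset.sum_congr rfl fun _ _ => Finset.sum_congr rfl fun _ _ => by ring

end IsMetricOn

theorem IsMaximallySymmetricOn.riemannUpOn_eq {L : ℝ} {U : Set (Coords n)} {g : MetricField n}
    (hg : IsMaximallySymmetricOn L U g) (hU : IsOpen U) {x : Coords n} (hx : x ∈ U)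
    (Z k p X : Coords n) : riemannUpOn g x Z k p X =
      2 * L / (((n : ℝ) - 2) * ((n : ℝ) - 1)) *
        ((∑ a, Z a * p a) * (∑ d, lower (g x) k d * X d)
          - (∑ a, Z a * X a) * (∑ c, lower (g x) k c * p c)) :=
  hg.sum_riemannUp (hg.lorentz.isMetricOn hU) hx k Z p X

theorem sum_riemannUp_sub (g gbar : MetricField n) (x k Z p X : Coords n) :
    ∑ a, ∑ c, ∑ d, Z a * p c * X d *
      ∑ b, (riemannUp gbar a b c d x - riemannUp g a b c d x) * k b
      = riemannUpOn gbar x Z k p X - riemannUpOn g x Z k p X := by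
  simp only [riemannUpOn, sub_mul, mul_sub, Finset.sum_sub_distrib]

section KerrSchildMetrics

variable {L : ℝ} {U : Set (Coords n)} {g gbar : MetricField n} {H K : Coords n → ℝ}
  {k m : Coords n → Coords n}

theorem IsExtendedKerrSchild.sub_eq (h : IsExtendedKerrSchild L U g gbar H K k m) {x : Coords n}
    (hx : x ∈ U) (a b : Fin n) : gbar x a b - g x a b
      = 2 * H x * lower (g x) (k x) a * lower (g x) (k x) b
        + K x * (lower (g x) (k x) a * lower (g x) (m x) b
          + lower (g x) (k x) b * lower (g x) (m x) a) := by
  have := h.ansatz x hx a b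
  linarith

theorem IsExtendedKerrSchild.commonNullGeodetic (h : IsExtendedKerrSchild L U g gbar H K k m)
    (hgeo : IsGeodeticOn U g k) : CommonNullGeodetic U g gbar k where
  metric := h.metric.isMetricOn h.isOpen
  background := h.background.lorentz.isMetricOn h.isOpen
  smooth x hx a := contDiffAt_pi.1 (h.smooth_k.contDiffAt (h.isOpen.mem_nhds hx)) a
  ne := h.k_ne
  null := h.k_null
  geodetic := hgeo
  lower_eq x hx a := by
    have h1 : lower (gbar x) (k x) a - lower (g x) (k x) a
        = (2 * H x * lower (g x) (k x) a + K x * lower (g x) (m x) a)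
          * (∑ b, lower (g x) (k x) b * k x b)
          + K x * lower (g x) (k x) a * ∑ b, lower (g x) (m x) b * k x b := by
      conv_lhs => simp only [lower]
      rw [← Finset.sum_sub_distrib, Finset.mul_sum, Finset.mul_sum, ← Finset.sum_add_distrib]
      refine Finset.sum_congr rfl fun b _ => ?_
      rw [← sub_mul, h.sub_eq hx]; ring
    rw [sum_lower_mul, sum_lower_mul, h.k_null x hx, h.k_m x hx] at h1
    linarith

theorem IsGeneralizedKerrSchild.sub_eq (h : IsGeneralizedKerrSchild L U g gbar H k) {x : Coords n}
    (hx : x ∈ U) (a b : Fin n) : gbar x a b - g x a b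
      = 2 * H x * lower (g x) (k x) a * lower (g x) (k x) b := by
  have := h.ansatz x hx a b
  linarith

theorem IsGeneralizedKerrSchild.commonNullGeodetic (h : IsGeneralizedKerrSchild L U g gbar H k)
    (hgeo : IsGeodeticOn U g k) : CommonNullGeodetic U g gbar k where
  metric := h.metric.isMetricOn h.isOpen
  background := h.background.lorentz.isMetricOn h.isOpen
  smooth x hx a := contDiffAt_pi.1 (h.smooth_k.contDiffAt (h.isOpen.mem_nhds hx)) a
  ne := h.k_ne
  null := h.k_null
  geodetic := hgeo
  lower_eq x hx a := by
    have h1 : lower (gbar x) (k x) a - lower (g x) (k x) a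
        = 2 * H x * lower (g x) (k x) a * ∑ b, lower (g x) (k x) b * k x b := by
      conv_lhs => simp only [lower]
      rw [← Finset.sum_sub_distrib, Finset.mul_sum]
      refine Finset.sum_congr rfl fun b _ => ?_
      rw [← sub_mul, h.sub_eq hx]; ring
    rw [sum_lower_mul, h.k_null x hx] at h1
    linarith

/-- The boost weight `2` components of the curvature of an extended Kerr–Schild metric vanish. -/
theorem IsExtendedKerrSchild.riemannUpOn_null (h : IsExtendedKerrSchild L U g gbar H K k m)
    (hgeo : IsGeodeticOn U g k) {x : Coords n} (hx : x ∈ U) (Z X : Coords n)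
    (hZ : ∑ a, Z a * k x a = 0) (hX : ∑ a, lower (g x) (k x) a * X a = 0) :
    riemannUpOn g x Z (k x) (k x) X = 0 := by
  have hc := h.commonNullGeodetic hgeo
  have hm : ∀ x ∈ U, ∀ a, ContDiffAt ℝ ∞ (fun y => m y a) x := fun x hx a =>
    contDiffAt_pi.1 (h.smooth_m.contDiffAt (h.isOpen.mem_nhds hx)) a
  obtain ⟨f, V, hf, hV, hT, hfk⟩ := hc.exists_smooth_decomposition fun y hy =>
    hc.covDerivDiff_extended hy (μ := fun y => lower (g y) (m y))
      (h.smooth_H.contDiffAt (h.isOpen.mem_nhds hy)) (h.smooth_K.contDiffAt (h.isOpen.mem_nhds hy))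
      (fun a => ContDiffAt.sum fun b _ => (hc.metric.smooth y hy a b).mul (hm y hy b))
      (fun y hy => by rw [sum_lower_mul]; exact h.k_m y hy) (fun y hy => h.sub_eq hy)
  have h1 := hc.curvature_diff_null hx (hf x hx) (hV x hx) hT (hfk x hx) Z X hZ (Or.inl hX)
  rw [sum_riemannUp_sub, h.background.riemannUpOn_eq h.isOpen hx, hZ,
    sum_lower_mul, sum_lower_mul, hc.background.ip_comm hx, ← sum_lower_mul,
    ← sum_lower_mul] at h1
  have h2 : ∑ a, lower (gbar x) (k x) a * k x a = 0 := by
    simp only [hc.lower_eq x hx]; exact hc.sum_lower_self hx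
  rw [h2] at h1
  linarith

/-- For a generalized Kerr–Schild metric, `∇̄_b kᵃ - ∇_b kᵃ = kᵃ f_b` with a smooth covector field
`f` that is proportional to `k_b`. -/
theorem IsGeneralizedKerrSchild.exists_smooth_factor (h : IsGeneralizedKerrSchild L U g gbar H k)
    (hgeo : IsGeodeticOn U g k) :
    ∃ f : Coords n → Coords n, (∀ x ∈ U, ∀ a, ContDiffAt ℝ ∞ (fun y => f y a) x) ∧
      (∀ x ∈ U, ∀ a d, covDerivDiff g gbar k a d x = k x a * f x d) ∧
      ∀ x ∈ U, ∀ X : Coords n, ∑ a, lower (g x) (k x) a * X a = 0 → ∑ a, f x a * X a = 0 := by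
  have hc := h.commonNullGeodetic hgeo
  have hT : ∀ y ∈ U, ∃ t : ℝ, ∀ a d, covDerivDiff g gbar k a d y
      = k y a * (t * lower (g y) (k y) d) := fun y hy =>
    hc.covDerivDiff_generalized hy (h.smooth_H.contDiffAt (h.isOpen.mem_nhds hy))
      fun y hy => h.sub_eq hy
  obtain ⟨f, hf, hfT⟩ := KerrSchild.exists_smooth_factor (T := covDerivDiff g gbar k)
    (fun y hy => hc.contDiffAt_covDerivDiff hy) hc.smooth hc.ne
    fun y hy => (hT y hy).imp' (fun t d => t * lower (g y) (k y) d) fun t ht => ht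
  refine ⟨f, hf, hfT, fun x hx X hX => ?_⟩
  obtain ⟨a, ha⟩ := Function.ne_iff.1 (h.k_ne x hx)
  obtain ⟨t, ht⟩ := hT x hx
  have h1 : ∀ d, f x d = t * lower (g x) (k x) d := fun d =>
    mul_left_cancel₀ ha ((hfT x hx a d).symm.trans (ht a d))
  simp only [h1, mul_assoc, ← Finset.mul_sum, hX, mul_zero]

/-- In the generalized case `X` need not be orthogonal to `k`, so that components of the type
`R_{010i}` vanish as well. -/
theorem IsGeneralizedKerrSchild.riemannUpOn_null (h : IsGeneralizedKerrSchild L U g gbar H k)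
    (hgeo : IsGeodeticOn U g k) {x : Coords n} (hx : x ∈ U) (Z X : Coords n)
    (hZ : ∑ a, Z a * k x a = 0) : riemannUpOn g x Z (k x) (k x) X = 0 := by
  have hc := h.commonNullGeodetic hgeo
  obtain ⟨f, hf, hfT, hfX⟩ := h.exists_smooth_factor hgeo
  have h1 := hc.curvature_diff_null hx (V := 0) (hf x hx) (fun _ => contDiffAt_const)
    (fun y hy a d => by rw [hfT y hy]; simp) (hfX x hx _ (hc.sum_lower_self hx)) Z X hZ
    (Or.inr rfl)
  rw [sum_riemannUp_sub, h.background.riemannUpOn_eq h.isOpen hx, hZ] at h1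
  simp only [hc.lower_eq x hx, hc.sum_lower_self hx] at h1
  linarith

/-- The components of the type `R_{0ijk}` of the curvature of a generalized Kerr–Schild metric
vanish. -/
theorem IsGeneralizedKerrSchild.riemannUpOn_transverse
    (h : IsGeneralizedKerrSchild L U g gbar H k) (hgeo : IsGeodeticOn U g k) {x : Coords n}
    (hx : x ∈ U) (Z X Y : Coords n) (hZ : ∑ a, Z a * k x a = 0)
    (hX : ∑ a, lower (g x) (k x) a * X a = 0) (hY : ∑ a, lower (g x) (k x) a * Y a = 0) :
    riemannUpOn g x Z (k x) X Y = 0 := by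
  have hc := h.commonNullGeodetic hgeo
  obtain ⟨f, hf, hfT, hfX⟩ := h.exists_smooth_factor hgeo
  have h1 := hc.curvature_diff_transverse hx (hf x hx) hfT Z X Y hZ hX hY (hfX x hx X hX)
    (hfX x hx Y hY) fun X Y hX hY => hc.christoffel_diff_generalized hx
      (h.smooth_H.contDiffAt (h.isOpen.mem_nhds hx)) (fun y hy => h.sub_eq hy) Z X Y hZ hX hY
  rw [sum_riemannUp_sub, h.background.riemannUpOn_eq h.isOpen hx] at h1
  simp only [hc.lower_eq x hx, hX, hY] at h1
  linarith

end KerrSchildMetrics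

section Frames

theorem ip_mulVec (P : Matrix (Fin n) (Fin n) ℝ) (G : Matrix (Fin n) (Fin n) ℝ)
    (v w : Coords n) : ip G (P *ᵥ v) (P *ᵥ w) = ip (Pᵀ * G * P) v w := by
  have h : ∀ (G : Matrix (Fin n) (Fin n) ℝ) v w, ip G v w = v ⬝ᵥ (G *ᵥ w) := by
    intro G v w
    simp only [ip, dotProduct, Matrix.mulVec, Finset.mul_sum]
    exact Finset.sum_congr rfl fun _ _ => Finset.sum_congr rfl fun _ _ => by ring
  rw [h, h, ← Matrix.mulVec_mulVec, ← Matrix.mulVec_mulVec, Matrix.dotProduct_mulVec v,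
    Matrix.vecMul_transpose]

theorem ip_minkowski_cons (m : ℕ) (v w : Coords (m + 1)) :
    ip (minkowski (m + 1)) v w = -(v 0 * w 0) + ∑ i : Fin m, v i.succ * w i.succ := by
  have : ∀ a, ∑ b, minkowski (m + 1) a b * v a * w b
      = (if a.val = 0 then -1 else 1) * (v a * w a) := by
    intro a
    simp [minkowski, Matrix.diagonal_apply]
  simp only [ip, this, Fin.sum_univ_succ]
  simp

/-- A nonzero null vector of a Lorentzian scalar product can be completed to a null frame. -/
theorem exists_nullFrame (hn : 2 ≤ n) {G P : Matrix (Fin n) (Fin n) ℝ} (hP : IsUnit P.det)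
    (hG : Pᵀ * G * P = minkowski n) {l : Coords n} (hl : l ≠ 0) (hnull : ip G l l = 0) :
    ∃ F : NullFrame G, F.ell = l := by
  obtain ⟨m, rfl⟩ : ∃ m, n = m + 1 + 1 := ⟨n - 2, by omega⟩
  obtain ⟨v, rfl⟩ : ∃ v, P *ᵥ v = l :=
    ⟨P⁻¹ *ᵥ l, by rw [Matrix.mulVec_mulVec, Matrix.mul_nonsing_inv _ hP, Matrix.one_mulVec]⟩
  have hip : ∀ v w, ip G (P *ᵥ v) (P *ᵥ w)
      = -(v 0 * w 0) + ∑ i : Fin (m + 1), v i.succ * w i.succ := by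
    intro v w; rw [ip_mulVec, hG, ip_minkowski_cons]
  rw [hip] at hnull
  -- the spatial part of the null vector, and an orthonormal basis of its orthogonal complement
  obtain ⟨s, hs⟩ : ∃ s : EuclideanSpace ℝ (Fin (m + 1)), ∀ i, s i = v (Fin.succ i) :=
    ⟨WithLp.toLp 2 fun i => v (Fin.succ i), fun _ => rfl⟩
  have hinner : ∀ a b : EuclideanSpace ℝ (Fin (m + 1)), inner ℝ a b = ∑ i, a i * b i := by
    intro a b
    simp [PiLp.inner_apply, mul_comm]
  have hv0 : v 0 ≠ 0 := by
    intro h0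
    rw [h0] at hnull
    have h1 : ∀ i : Fin (m + 1), v i.succ = 0 := fun i => by
      have := (Finset.sum_eq_zero_iff_of_nonneg (f := fun i : Fin (m + 1) => v i.succ * v i.succ)
        fun i _ => mul_self_nonneg _).1 (by linarith) i (Finset.mem_univ i)
      exact mul_self_eq_zero.1 this
    apply hl
    have : v = 0 := funext fun i => Fin.cases h0 h1 i
    rw [this, Matrix.mulVec_zero]
  have hs0 : s ≠ 0 := by
    intro h0
    have h1 : ∀ i : Fin (m + 1), v i.succ = 0 := fun i => by rw [← hs, h0]; rfl
    simp only [h1] at hnull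
    apply hv0
    simpa using hnull
  have : Fact (Module.finrank ℝ (EuclideanSpace ℝ (Fin (m + 1))) = m + 1) := ⟨by simp⟩
  let e := OrthonormalBasis.fromOrthogonalSpanSingleton (𝕜 := ℝ) m hs0
  have he : ∀ i j, ∑ p, (e i : EuclideanSpace ℝ (Fin (m + 1))) p
      * (e j : EuclideanSpace ℝ (Fin (m + 1))) p = if i = j then 1 else 0 := by
    intro i j
    rw [← hinner]
    exact orthonormal_iff_ite.1 e.orthonormal i j
  have hse : ∀ i, ∑ p, v p.succ * (e i : EuclideanSpace ℝ (Fin (m + 1))) p = 0 := by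
    intro i
    have := Submodule.mem_orthogonal_singleton_iff_inner_right.1 (e i).2
    rw [hinner] at this
    simpa only [hs] using this
  let N : Coords (m + 1 + 1) := Fin.cons (-v 0 / (2 * v 0 ^ 2)) fun i => v i.succ / (2 * v 0 ^ 2)
  let E : Fin m → Coords (m + 1 + 1) := fun i =>
    Fin.cons 0 fun p => (e i : EuclideanSpace ℝ (Fin (m + 1))) p
  have hsq : ∑ i : Fin (m + 1), v i.succ * v i.succ = v 0 ^ 2 := by linarith
  refine ⟨⟨P *ᵥ v, P *ᵥ N, fun i => P *ᵥ E i, ?_, ?_, ?_, fun i => ?_, fun i => ?_,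
    fun i j => ?_⟩, rfl⟩
  · rw [hip]; exact hnull
  · rw [hip]
    simp only [N, Fin.cons_zero, Fin.cons_succ, div_mul_div_comm, ← Finset.sum_div, hsq]
    ring
  · rw [hip]
    simp only [N, Fin.cons_zero, Fin.cons_succ, mul_div_assoc', ← Finset.sum_div, hsq]
    field_simp
    norm_num
  · rw [hip]
    simp only [E, Fin.cons_zero, Fin.cons_succ, hse i]
    ring
  · rw [hip]
    simp only [N, E, Fin.cons_zero, Fin.cons_succ, div_mul_eq_mul_div, ← Finset.sum_div, hse i]
    ring
  · rw [hip]
    simp only [E, Fin.cons_zero, Fin.cons_succ]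
    rw [he i j]
    simp only [mul_zero, neg_zero, zero_add]

end Frames

section WeylAligned

variable {L : ℝ} {U : Set (Coords n)} {g gbar : MetricField n} {H K : Coords n → ℝ}
  {k m : Coords n → Coords n}

/-- A null vector is a Weyl aligned null direction when the boost weight `2` components of the
Riemann tensor vanish: the trace part of the Weyl tensor then only contributes the Ricci component
along `l`, which is a trace of such components. -/
theorem isWAND_of_riemannUpOn (hn : 2 ≤ n) (hg : IsLorentzMetricOn U g) (hU : IsOpen U)
    {x l : Coords n} (hx : x ∈ U) (hl : l ≠ 0) (hnull : ip (g x) l l = 0)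
    (hR : ∀ Z X : Coords n, ∑ a, Z a * l a = 0 → ∑ a, lower (g x) l a * X a = 0 →
      riemannUpOn g x Z l l X = 0) : IsWAND g x l := by
  have hm := hg.isMetricOn hU
  obtain ⟨P, hP, hG⟩ := hg.signature x hx
  refine ⟨exists_nullFrame hn hP hG hl hnull, ?_⟩
  rintro F rfl i j
  have hric : ricciOn g x F.ell F.ell = 0 := by
    refine hm.ricciOn_eq_zero hx hl hnull (fun Z X hZ hX => ?_) fun Z => ?_
    · rw [riemannUpOn_antisymm, hR Z X hZ hX, neg_zero]
    · have := riemannUpOn_antisymm g x Z F.ell F.ell F.ell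
      linarith
  have hriem : riemannOn g x F.ell (F.mm i) F.ell (F.mm j) = 0 := by
    rw [hm.riemannOn_antisymm hx, hm.riemannOn_eq hx, hR, neg_zero]
    · rw [sum_lower_mul, F.ell_mm]
    · rw [sum_lower_mul, hm.ip_comm hx, F.ell_mm]
  rw [weyl0i0j, weylOn_eq, hriem, hric, F.ell_mm, hm.ip_comm hx (F.mm i) F.ell, F.ell_mm,
    F.ell_null]
  ring

theorem IsExtendedKerrSchild.isWAND (hn : 2 ≤ n) (h : IsExtendedKerrSchild L U g gbar H K k m)
    (hgeo : IsGeodeticOn U g k) {x : Coords n} (hx : x ∈ U) : IsWAND g x (k x) :=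
  isWAND_of_riemannUpOn hn h.metric h.isOpen hx (h.k_ne x hx) (h.k_null x hx)
    fun Z X hZ hX => h.riemannUpOn_null hgeo hx Z X hZ hX

theorem IsGeneralizedKerrSchild.isMultipleWAND (hn : 2 ≤ n)
    (h : IsGeneralizedKerrSchild L U g gbar H k) (hgeo : IsGeodeticOn U g k) {x : Coords n}
    (hx : x ∈ U) : IsMultipleWAND g x (k x) := by
  have hm := h.metric.isMetricOn h.isOpen
  have hnull : ∀ Y : Coords n, ip (g x) (k x) Y = 0 → ∀ N : Coords n,
      riemannOn g x (k x) N (k x) Y = 0 := by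
    intro Y hY N
    rw [hm.riemannOn_pair hx, hm.riemannOn_antisymm hx, hm.riemannOn_eq hx,
      h.riemannUpOn_null hgeo hx _ _ (by rw [sum_lower_mul]; exact hY), neg_zero]
  have hric : ∀ Y : Coords n, ip (g x) (k x) Y = 0 → ricciOn g x Y (k x) = 0 := by
    intro Y hY
    have hY' : ∑ a, lower (g x) (k x) a * Y a = 0 := by
      rw [sum_lower_mul, hm.ip_comm hx]; exact hY
    rw [hm.ricciOn_symm hx]
    refine hm.ricciOn_eq_zero hx (h.k_ne x hx) (h.k_null x hx) (fun Z X hZ hX =>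
      h.riemannUpOn_transverse hgeo hx Z X Y hZ hX hY') fun Z => ?_
    obtain ⟨z, hz⟩ := hm.exists_lower_eq hx Z
    have : Z = lower (g x) z := funext fun a => by
      rw [hz, lower]
      exact Finset.sum_congr rfl fun d _ => by rw [hm.symm x hx d a]; ring
    rw [this, ← hm.riemannOn_eq hx, hm.riemannOn_antisymm hx, hnull Y hY, neg_zero]
  refine ⟨isWAND_of_riemannUpOn hn h.metric h.isOpen hx (h.k_ne x hx) (h.k_null x hx)
    fun Z X hZ hX => h.riemannUpOn_null hgeo hx Z X hZ, fun F hF => ⟨fun i => ?_, fun i j l => ?_⟩⟩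
  · have h0 := F.ell_mm i
    have h1 := F.ell_null
    rw [weyl010i, weylOn_eq]
    rw [hF] at h0 h1 ⊢
    rw [hnull _ h0, hric _ h0, hric _ h1, h0, h1]
    ring
  · have hi := F.ell_mm i
    have hj := F.ell_mm j
    have hl := F.ell_mm l
    rw [weyl0ijk, weylOn_eq]
    rw [hF] at hi hj hl ⊢
    rw [hric _ hj, hric _ hl, hj, hl, hm.riemannOn_antisymm hx, hm.riemannOn_eq hx,
      h.riemannUpOn_transverse hgeo hx _ _ _ (by rw [sum_lower_mul]; exact hi)
        (by rw [sum_lower_mul, hm.ip_comm hx]; exact hj)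
        (by rw [sum_lower_mul, hm.ip_comm hx]; exact hl)]
    ring

end WeylAligned

/-! ### A spacetime whose null field is not a multiple aligned direction -/

/-- The metric `η_{ab} + v² (k_a μ_b + k_b μ_a)` with constant vectors `k`, `N`, `μ`, whose indices
are lowered by `η`, and the coordinate function `v = N_a xᵃ`. -/
noncomputable def waveMetric (k N μ : Coords n) : MetricField n := fun x =>
  minkowski n + (ip (minkowski n) N x) ^ 2 •
    (Matrix.vecMulVec (lower (minkowski n) k) (lower (minkowski n) μ)
      + Matrix.vecMulVec (lower (minkowski n) μ) (lower (minkowski n) k))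

theorem waveMetric_apply (k N μ x : Coords n) (a b : Fin n) : waveMetric k N μ x a b =
    minkowski n a b + (ip (minkowski n) N x) ^ 2 *
      (lower (minkowski n) k a * lower (minkowski n) μ b
        + lower (minkowski n) μ a * lower (minkowski n) k b) := by
  simp [waveMetric, Matrix.vecMulVec_apply, mul_add]

theorem waveMetric_zero (k N μ : Coords n) : waveMetric k N μ 0 = minkowski n := by
  ext a b
  have : ip (minkowski n) N 0 = 0 := by simp [ip]
  rw [waveMetric_apply, this]; ring

theorem minkowski_isMetricOn : IsMetricOn Set.univ (fun _ : Coords n => minkowski n) :=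
  minkowski_isMaximallySymmetricOn.lorentz.isMetricOn isOpen_univ

theorem ip_minkowski_comm (v w : Coords n) : ip (minkowski n) v w = ip (minkowski n) w v :=
  minkowski_isMetricOn.ip_comm (Set.mem_univ (0 : Coords n)) v w

theorem sum_minkowski_mul_lower (v : Coords n) (a : Fin n) :
    ∑ b, minkowski n a b * lower (minkowski n) v b = v a := by
  simp only [lower, Finset.mul_sum, ← mul_assoc]
  rw [Finset.sum_comm]
  simp only [← Finset.sum_mul, sum_minkowski]
  simp

theorem contDiff_ip (v : Coords n) : ContDiff ℝ ∞ (ip (minkowski n) v) := by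
  unfold ip
  fun_prop

theorem pd_ip (v : Coords n) (a : Fin n) (x : Coords n) :
    pd a (ip (minkowski n) v) x = lower (minkowski n) v a := by
  have h1 : ∀ y, ip (minkowski n) v y = ∑ b, lower (minkowski n) v b * y b := fun y => by
    rw [sum_lower_mul, ip_minkowski_comm]
  have h2 : ip (minkowski n) v = fun y => ∑ b, lower (minkowski n) v b * y b := funext h1
  have hd : ∀ b : Fin n, HasFDerivAt (fun y : Coords n => y b)
      (ContinuousLinearMap.proj (R := ℝ) (φ := fun _ : Fin n => ℝ) b) x := fun b =>
    hasFDerivAt_apply b x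
  have h3 : ∀ b, pd a (fun y : Coords n => y b) x = if b = a then 1 else 0 := by
    intro b
    unfold pd
    rw [(hd b).fderiv]
    simp [Pi.single_apply]
  rw [h2, pd_sum _ fun b => (differentiableAt_const _).fun_mul (hd b).differentiableAt]
  simp only [pd_mul (differentiableAt_const _) (hd _).differentiableAt, pd_const, h3]
  simp

section WaveMetric

variable {k N μ : Coords n}

theorem pd_waveMetric (a b c : Fin n) (x : Coords n) :
    pd c (fun y => waveMetric k N μ y a b) x = 2 * ip (minkowski n) N x *
      (lower (minkowski n) N c * (lower (minkowski n) k a * lower (minkowski n) μ b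
        + lower (minkowski n) μ a * lower (minkowski n) k b)) := by
  have hd := (contDiff_ip N).contDiffAt (x := x) |>.differentiableAt (by simp)
  simp only [waveMetric_apply, pow_two]
  rw [pd_add (differentiableAt_const _) ((hd.fun_mul hd).fun_mul (differentiableAt_const _)),
    pd_mul (hd.fun_mul hd) (differentiableAt_const _), pd_mul hd hd, pd_const, pd_const, pd_ip]
  ring

theorem pd_pd_waveMetric (a b c d : Fin n) (x : Coords n) :
    pd d (pd c (fun y => waveMetric k N μ y a b)) x = 2 * lower (minkowski n) N d *
      (lower (minkowski n) N c * (lower (minkowski n) k a * lower (minkowski n) μ b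
        + lower (minkowski n) μ a * lower (minkowski n) k b)) := by
  have hd := (contDiff_ip N).contDiffAt (x := x) |>.differentiableAt (by simp)
  have : pd c (fun y => waveMetric k N μ y a b) = fun x => _ := funext (pd_waveMetric a b c)
  rw [this, pd_mul ((differentiableAt_const _).fun_mul hd) (differentiableAt_const _),
    pd_mul (differentiableAt_const _) hd, pd_const, pd_const, pd_ip]
  ring

variable (hkk : ip (minkowski n) k k = 0) (hkμ : ip (minkowski n) k μ = 0)

include hkk hkμ

theorem lower_waveMetric_null (x : Coords n) (a : Fin n) :
    lower (waveMetric k N μ x) k a = lower (minkowski n) k a := by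
  have : lower (waveMetric k N μ x) k a = lower (minkowski n) k a
      + ip (minkowski n) N x ^ 2 * (lower (minkowski n) k a *
        (∑ b, lower (minkowski n) μ b * k b)
        + lower (minkowski n) μ a * ∑ b, lower (minkowski n) k b * k b) := by
    conv_lhs => unfold lower
    rw [Finset.mul_sum, Finset.mul_sum, ← Finset.sum_add_distrib, Finset.mul_sum]
    conv_rhs => enter [1]; unfold lower
    rw [← Finset.sum_add_distrib]
    exact Finset.sum_congr rfl fun b _ => by rw [waveMetric_apply]; ring
  rw [this, sum_lower_mul, sum_lower_mul, hkk, hkμ]; ring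

theorem waveMetric_isLorentzMetricOn :
    IsLorentzMetricOn Set.univ (waveMetric k N μ) where
  smooth a b := by
    simp only [waveMetric_apply]
    have := contDiff_ip N
    exact (contDiff_const.add ((this.pow 2).mul contDiff_const)).contDiffOn
  signature x _ := by
    obtain ⟨t, ht⟩ : ∃ t, t = ip (minkowski n) N x ^ 2 := ⟨_, rfl⟩
    have hηT : (minkowski n)ᵀ = minkowski n := by rw [minkowski, Matrix.diagonal_transpose]
    have h1 : (waveMetric k N μ x) *ᵥ k = lower (minkowski n) k :=
      funext fun a => lower_waveMetric_null hkk hkμ x a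
    have h2 : k ᵥ* minkowski n = lower (minkowski n) k := by
      rw [← Matrix.mulVec_transpose, hηT]; rfl
    have h3 : k ⬝ᵥ lower (minkowski n) μ = 0 := by
      rw [dotProduct_comm, dotProduct, sum_lower_mul, hkμ]
    -- the shear taking a vector `w` to `w - v² (μ · w) k`
    obtain ⟨P, hP⟩ : ∃ P, P = 1 - t • Matrix.vecMulVec k (lower (minkowski n) μ) := ⟨_, rfl⟩
    have h4 : waveMetric k N μ x * P = minkowski n
        + t • Matrix.vecMulVec (lower (minkowski n) μ) (lower (minkowski n) k) := by
      rw [hP, Matrix.mul_sub, Matrix.mul_one, Matrix.mul_smul, Matrix.mul_vecMulVec, h1,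
        waveMetric, ← ht, smul_add]
      abel
    have h5 : Pᵀ * waveMetric k N μ x * P = minkowski n := by
      rw [Matrix.mul_assoc, h4, hP, Matrix.transpose_sub, Matrix.transpose_one,
        Matrix.transpose_smul, Matrix.transpose_vecMulVec, Matrix.sub_mul, Matrix.one_mul,
        Matrix.smul_mul, Matrix.mul_add, Matrix.vecMulVec_mul, h2, Matrix.mul_smul,
        Matrix.vecMulVec_mul_vecMulVec, h3]
      simp
    refine ⟨P, ?_, h5⟩
    have h6 := congrArg Matrix.det h5
    rw [Matrix.det_mul] at h6
    have h7 : (minkowski n).det ≠ 0 := minkowski_isMetricOn.det (0 : Coords n) trivial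
    rw [← h6] at h7
    exact (right_ne_zero_of_mul h7).isUnit

theorem waveMetric_isGeodeticOn : IsGeodeticOn Set.univ (waveMetric k N μ) (fun _ => k) := by
  intro x _
  refine ⟨0, fun a => ?_⟩
  have hq : ∀ e d, ∑ c, k c * pd e (fun y => waveMetric k N μ y d c) x = 0 := by
    intro e d
    have : ∑ c, k c * pd e (fun y => waveMetric k N μ y d c) x
        = 2 * ip (minkowski n) N x * lower (minkowski n) N e * (lower (minkowski n) k d *
          (∑ c, lower (minkowski n) μ c * k c)
          + lower (minkowski n) μ d * ∑ c, lower (minkowski n) k c * k c) := by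
      rw [Finset.mul_sum, Finset.mul_sum, ← Finset.sum_add_distrib, Finset.mul_sum]
      exact Finset.sum_congr rfl fun c _ => by rw [pd_waveMetric]; ring
    rw [this, sum_lower_mul, sum_lower_mul, hkk, hkμ]; ring
  have h1 : acceleration (waveMetric k N μ) (fun _ => k) a x
      = (1 / 2) * ∑ d, (waveMetric k N μ x)⁻¹ a d *
        (∑ b, k b * (∑ c, k c * pd b (fun y => waveMetric k N μ y d c) x)
          + ∑ b, ∑ c, k b * (k c * pd c (fun y => waveMetric k N μ y d b) x)
          - ∑ b, k b * (∑ c, k c * pd d (fun y => waveMetric k N μ y b c) x)) := by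
    simp only [acceleration, pd_const, zero_add, christoffel, Finset.mul_sum, Finset.sum_mul,
      ← Finset.sum_add_distrib, ← Finset.sum_sub_distrib]
    refine (Finset.sum_congr rfl fun b _ => Finset.sum_comm).trans ?_
    rw [Finset.sum_comm]
    exact Finset.sum_congr rfl fun _ _ => Finset.sum_congr rfl fun _ _ =>
      Finset.sum_congr rfl fun _ _ => by ring
  have h2 : ∀ d, ∑ b, ∑ c, k b * (k c * pd c (fun y => waveMetric k N μ y d b) x) = 0 := by
    intro d
    rw [Finset.sum_comm]
    simp only [mul_left_comm (k _) (k _), ← Finset.mul_sum, hq, mul_zero, Finset.sum_const_zero]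
  rw [h1]
  simp only [h2, hq, mul_zero, Finset.sum_const_zero, add_zero, sub_zero, zero_mul]

/-- The metric `waveMetric k N μ` is an extended Kerr–Schild metric with `H = 0` and `K = -v²`; the
unit vector field is `μ - v² k`, whose lowered components are those of `μ` in the background. -/
theorem waveMetric_isExtendedKerrSchild (hk : k ≠ 0) (hμμ : ip (minkowski n) μ μ = 1) :
    IsExtendedKerrSchild 0 Set.univ (waveMetric k N μ) (fun _ => minkowski n) (fun _ => 0)
      (fun x => -ip (minkowski n) N x ^ 2) (fun _ => k)
      (fun x => μ - ip (minkowski n) N x ^ 2 • k) := by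
  have hlower : ∀ (x : Coords n) a, lower (waveMetric k N μ x)
      (μ - ip (minkowski n) N x ^ 2 • k) a = lower (minkowski n) μ a := by
    intro x a
    have h1 : lower (waveMetric k N μ x) (μ - ip (minkowski n) N x ^ 2 • k) a
        = lower (waveMetric k N μ x) μ a
          - ip (minkowski n) N x ^ 2 * lower (waveMetric k N μ x) k a := by
      simp only [lower, Finset.mul_sum, ← Finset.sum_sub_distrib]
      exact Finset.sum_congr rfl fun b _ => by
        rw [Pi.sub_apply, Pi.smul_apply, smul_eq_mul]; ring
    have h2 : lower (waveMetric k N μ x) μ a = lower (minkowski n) μ a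
        + ip (minkowski n) N x ^ 2 * (lower (minkowski n) k a *
          (∑ b, lower (minkowski n) μ b * μ b)
          + lower (minkowski n) μ a * ∑ b, lower (minkowski n) k b * μ b) := by
      conv_lhs => unfold lower
      rw [Finset.mul_sum, Finset.mul_sum, ← Finset.sum_add_distrib, Finset.mul_sum]
      conv_rhs => enter [1]; unfold lower
      rw [← Finset.sum_add_distrib]
      exact Finset.sum_congr rfl fun b _ => by rw [waveMetric_apply]; ring
    rw [h1, h2, lower_waveMetric_null hkk hkμ, sum_lower_mul, sum_lower_mul, hμμ,
      ip_minkowski_comm μ k, hkμ]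
    ring
  have hip : ∀ (x w : Coords n), ip (waveMetric k N μ x) k w = ip (minkowski n) k w := by
    intro x w
    have hm := (waveMetric_isLorentzMetricOn (N := N) hkk hkμ).isMetricOn isOpen_univ
    rw [hm.ip_comm (Set.mem_univ x), ip_minkowski_comm, ← sum_lower_mul, ← sum_lower_mul]
    simp only [lower_waveMetric_null hkk hkμ]
  have hsub : ∀ (t : ℝ) (c : Coords n), ∑ a, c a * (μ - t • k) a
      = ∑ a, c a * μ a - t * ∑ a, c a * k a := by
    intro t c
    rw [Finset.mul_sum, ← Finset.sum_sub_distrib]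
    exact Finset.sum_congr rfl fun b _ => by
      rw [Pi.sub_apply, Pi.smul_apply, smul_eq_mul]; ring
  have hN := contDiff_ip (n := n) N
  refine ⟨isOpen_univ, waveMetric_isLorentzMetricOn hkk hkμ, minkowski_isMaximallySymmetricOn,
    contDiffOn_const, (hN.pow 2).neg.contDiffOn, contDiffOn_const,
    (contDiff_const.sub ((hN.pow 2).smul contDiff_const)).contDiffOn, fun _ _ => hk,
    fun x _ => by rw [hip, hkk], fun x _ => ?_, fun x _ => ?_, fun x _ a b => ?_⟩
  · rw [← sum_lower_mul]
    simp only [hlower]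
    rw [sum_lower_mul, hkμ]
  · rw [← sum_lower_mul]
    simp only [hlower]
    rw [hsub, sum_lower_mul, sum_lower_mul, hμμ, hkμ]; ring
  · rw [hlower, hlower, lower_waveMetric_null hkk hkμ, lower_waveMetric_null hkk hkμ,
      waveMetric_apply]
    ring

/-- At the origin the first derivatives of `waveMetric` vanish, so that its curvature consists of
second derivatives only. -/
theorem riemann_waveMetric_zero (a b c d : Fin n) : riemann (waveMetric k N μ) a b c d 0 =
    lower (minkowski n) N c * lower (minkowski n) N b * (lower (minkowski n) k a *
      lower (minkowski n) μ d + lower (minkowski n) μ a * lower (minkowski n) k d)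
    - lower (minkowski n) N c * lower (minkowski n) N a * (lower (minkowski n) k b *
      lower (minkowski n) μ d + lower (minkowski n) μ b * lower (minkowski n) k d)
    - lower (minkowski n) N d * lower (minkowski n) N b * (lower (minkowski n) k a *
      lower (minkowski n) μ c + lower (minkowski n) μ a * lower (minkowski n) k c)
    + lower (minkowski n) N d * lower (minkowski n) N a * (lower (minkowski n) k b *
      lower (minkowski n) μ c + lower (minkowski n) μ b * lower (minkowski n) k c) := by
  have hm := (waveMetric_isLorentzMetricOn (N := N) hkk hkμ).isMetricOn isOpen_univ
  have h0 : ip (minkowski n) N 0 = 0 := by simp [ip]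
  have hΓ : ∀ a b c, christoffelDown (waveMetric k N μ) a b c 0 = 0 := by
    intro a b c
    simp only [christoffelDown, pd_waveMetric, h0]
    ring
  rw [hm.riemann_eq (Set.mem_univ _)]
  simp only [hΓ, zero_mul, Finset.sum_const_zero, pd_pd_waveMetric]
  ring

theorem riemannOn_waveMetric_zero (p q r s : Coords n) :
    riemannOn (waveMetric k N μ) 0 p q r s =
    ip (minkowski n) r N * ip (minkowski n) q N * (ip (minkowski n) p k * ip (minkowski n) s μ
      + ip (minkowski n) p μ * ip (minkowski n) s k)
    - ip (minkowski n) r N * ip (minkowski n) p N * (ip (minkowski n) q k * ip (minkowski n) s μ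
      + ip (minkowski n) q μ * ip (minkowski n) s k)
    - ip (minkowski n) s N * ip (minkowski n) q N * (ip (minkowski n) p k * ip (minkowski n) r μ
      + ip (minkowski n) p μ * ip (minkowski n) r k)
    + ip (minkowski n) s N * ip (minkowski n) p N * (ip (minkowski n) q k * ip (minkowski n) r μ
      + ip (minkowski n) q μ * ip (minkowski n) r k) := by
  have h1 : ∀ e f g h : Coords n, ∑ a, ∑ b, ∑ c, ∑ d, (e a * p a) * ((f b * q b) * ((g c * r c) *
      (h d * s d))) = (∑ a, e a * p a) * ((∑ b, f b * q b) * ((∑ c, g c * r c) *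
        ∑ d, h d * s d)) := by
    intro e f g h
    simp only [← Finset.mul_sum, ← Finset.sum_mul]
  simp only [riemannOn, riemann_waveMetric_zero hkk hkμ, ← sum_lower_mul]
  obtain ⟨κ, hκ⟩ : ∃ κ : Coords n, κ = lower (minkowski n) k := ⟨_, rfl⟩
  obtain ⟨ν, hν⟩ : ∃ ν : Coords n, ν = lower (minkowski n) N := ⟨_, rfl⟩
  obtain ⟨m, hm⟩ : ∃ m : Coords n, m = lower (minkowski n) μ := ⟨_, rfl⟩
  rw [← hκ, ← hν, ← hm]
  have h2 : ∀ a b c d, (ν c * ν b * (κ a * m d + m a * κ d) - ν c * ν a * (κ b * m d + m b * κ d)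
      - ν d * ν b * (κ a * m c + m a * κ c) + ν d * ν a * (κ b * m c + m b * κ c))
      * p a * q b * r c * s d
      = (κ a * p a) * ((ν b * q b) * ((ν c * r c) * (m d * s d)))
      + (m a * p a) * ((ν b * q b) * ((ν c * r c) * (κ d * s d)))
      - (ν a * p a) * ((κ b * q b) * ((ν c * r c) * (m d * s d)))
      - (ν a * p a) * ((m b * q b) * ((ν c * r c) * (κ d * s d)))
      - (κ a * p a) * ((ν b * q b) * ((m c * r c) * (ν d * s d)))
      - (m a * p a) * ((ν b * q b) * ((κ c * r c) * (ν d * s d)))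
      + (ν a * p a) * ((κ b * q b) * ((m c * r c) * (ν d * s d)))
      + (ν a * p a) * ((m b * q b) * ((κ c * r c) * (ν d * s d))) := by
    intro a b c d; ring
  simp only [h2, Finset.sum_add_distrib, Finset.sum_sub_distrib, h1]
  ring

variable (hNN : ip (minkowski n) N N = 0) (hkN : ip (minkowski n) k N = 1)
  (hNμ : ip (minkowski n) N μ = 0)

include hNN hkN hNμ

theorem ricci_waveMetric_zero (a b : Fin n) : ricci (waveMetric k N μ) a b 0 =
    lower (minkowski n) N a * lower (minkowski n) μ b
      + lower (minkowski n) μ a * lower (minkowski n) N b := by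
  have hm := (waveMetric_isLorentzMetricOn (N := N) hkk hkμ).isMetricOn isOpen_univ
  have hinv : (minkowski n)⁻¹ = minkowski n := Matrix.inv_eq_left_inv minkowski_mul_self
  have h1 : ∀ v w : Coords n, ∑ c, ∑ e, minkowski n c e * (lower (minkowski n) v e *
      lower (minkowski n) w c) = ip (minkowski n) v w := by
    intro v w
    rw [← sum_lower_mul]
    simp only [← mul_assoc, ← Finset.sum_mul, sum_minkowski_mul_lower, mul_comm (v _)]
  simp only [ricci, hm.riemannUp_eq_inv (Set.mem_univ _), waveMetric_zero, hinv,
    riemann_waveMetric_zero hkk hkμ]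
  obtain ⟨κ, hκ⟩ : ∃ κ : Coords n, κ = lower (minkowski n) k := ⟨_, rfl⟩
  obtain ⟨ν, hν⟩ : ∃ ν : Coords n, ν = lower (minkowski n) N := ⟨_, rfl⟩
  obtain ⟨m, hm⟩ : ∃ m : Coords n, m = lower (minkowski n) μ := ⟨_, rfl⟩
  have hκm := h1 k μ
  have hmκ := h1 μ k
  have hκν := h1 k N
  have hmν := h1 μ N
  have hνν := h1 N N
  have hνκ := h1 N k
  have hνm := h1 N μ
  rw [hkμ, ← hκ, ← hm] at hκm
  rw [ip_minkowski_comm, hkμ, ← hκ, ← hm] at hmκ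
  rw [hkN, ← hκ, ← hν] at hκν
  rw [ip_minkowski_comm, hNμ, ← hm, ← hν] at hmν
  rw [hNN, ← hν] at hνν
  rw [ip_minkowski_comm, hkN, ← hκ, ← hν] at hνκ
  rw [hNμ, ← hm, ← hν] at hνm
  rw [← hκ, ← hν, ← hm]
  have h2 : ∀ c e, minkowski n c e * (ν c * ν a * (κ e * m b + m e * κ b)
      - ν c * ν e * (κ a * m b + m a * κ b) - ν b * ν a * (κ e * m c + m e * κ c)
      + ν b * ν e * (κ a * m c + m a * κ c))
      = ν a * m b * (minkowski n c e * (κ e * ν c)) + ν a * κ b * (minkowski n c e * (m e * ν c))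
      - (κ a * m b + m a * κ b) * (minkowski n c e * (ν e * ν c))
      - ν b * ν a * (minkowski n c e * (κ e * m c)) - ν b * ν a * (minkowski n c e * (m e * κ c))
      + ν b * κ a * (minkowski n c e * (ν e * m c))
      + ν b * m a * (minkowski n c e * (ν e * κ c)) := by
    intro c e; ring
  simp only [h2, Finset.sum_add_distrib, Finset.sum_sub_distrib, ← Finset.mul_sum, hκm, hmκ, hκν,
    hmν, hνν, hνκ, hνm]
  ring

theorem ricciOn_waveMetric_zero (p q : Coords n) : ricciOn (waveMetric k N μ) 0 p q =
    ip (minkowski n) p N * ip (minkowski n) q μ + ip (minkowski n) p μ * ip (minkowski n) q N := by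
  simp only [ricciOn, ricci_waveMetric_zero hkk hkμ hNN hkN hNμ, ← sum_lower_mul,
    Finset.sum_mul_sum, ← Finset.sum_add_distrib]
  exact Finset.sum_congr rfl fun _ _ => Finset.sum_congr rfl fun _ _ => by ring

end WaveMetric

/-- An extended Kerr–Schild spacetime with geodetic `k` whose Weyl tensor has nonzero components of
boost weight `1`. -/
theorem exists_extendedKerrSchild_not_multipleWAND (hn : 4 ≤ n) :
    ∃ (L : ℝ) (U : Set (Coords n)) (g gbar : MetricField n) (H K : Coords n → ℝ)
        (k m : Coords n → Coords n),
      IsExtendedKerrSchild L U g gbar H K k m ∧ IsGeodeticOn U g k ∧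
        ∃ x ∈ U, ∃ F : NullFrame (g x), F.ell = k x ∧
          (∃ i, weyl010i g x F i ≠ 0) ∧ ∃ i j l, weyl0ijk g x F i j l ≠ 0 := by
  obtain ⟨r, rfl⟩ : ∃ r, n = r + 4 := ⟨n - 4, by omega⟩
  have hip : ∀ v w : Coords (r + 4), ip (minkowski (r + 4)) v w
      = -(v 0 * w 0) + (v 1 * w 1 + ∑ i : Fin (r + 2), v i.succ.succ * w i.succ.succ) := by
    intro v w
    rw [ip_minkowski_cons, Fin.sum_univ_succ]
    rfl
  -- a null frame of Minkowski space, adapted to the coordinate axes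
  let k : Coords (r + 4) := Fin.cons 1 (Fin.cons 1 0)
  let N : Coords (r + 4) := Fin.cons (-1 / 2) (Fin.cons (1 / 2) 0)
  let e : Fin (r + 2) → Coords (r + 4) := fun i => Fin.cons 0 (Fin.cons 0 (Pi.single i 1))
  have hk0 : k 0 = 1 := rfl
  have hk1 : k 1 = 1 := rfl
  have hk2 : ∀ i : Fin (r + 2), k i.succ.succ = 0 := fun _ => rfl
  have hN0 : N 0 = -1 / 2 := rfl
  have hN1 : N 1 = 1 / 2 := rfl
  have hN2 : ∀ i : Fin (r + 2), N i.succ.succ = 0 := fun _ => rfl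
  have he0 : ∀ i, e i 0 = 0 := fun _ => rfl
  have he1 : ∀ i, e i 1 = 0 := fun _ => rfl
  have he2 : ∀ i j : Fin (r + 2), e i j.succ.succ = if j = i then 1 else 0 := fun i j => by
    simp [e, Pi.single_apply]
  have hkk : ip (minkowski (r + 4)) k k = 0 := by simp [hip, hk0, hk1, hk2]
  have hNN : ip (minkowski (r + 4)) N N = 0 := by simp [hip, hN0, hN1, hN2]; norm_num
  have hkN : ip (minkowski (r + 4)) k N = 1 := by
    simp [hip, hk0, hk1, hk2, hN0, hN1]; norm_num
  have hke : ∀ i, ip (minkowski (r + 4)) k (e i) = 0 := by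
    intro i; simp [hip, hk2, he0, he1]
  have hNe : ∀ i, ip (minkowski (r + 4)) N (e i) = 0 := by
    intro i; simp [hip, hN2, he0, he1]
  have hee : ∀ i j, ip (minkowski (r + 4)) (e i) (e j) = if i = j then 1 else 0 := by
    intro i j; simp [hip, he0, he1, he2, eq_comm]
  have hkne : k ≠ 0 := fun h => by
    have := congrFun h 0
    rw [hk0] at this
    exact one_ne_zero this
  have h0 := waveMetric_zero k N (e 0)
  have hkμ := hke 0
  have hNμ := hNe 0
  refine ⟨0, Set.univ, waveMetric k N (e 0), _, _, _, _, _,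
    waveMetric_isExtendedKerrSchild hkk hkμ hkne (by rw [hee]; simp),
    waveMetric_isGeodeticOn hkk hkμ, 0, Set.mem_univ _,
    ⟨k, N, e, by rw [h0, hkk], by rw [h0, hNN], by rw [h0, hkN], fun i => by rw [h0]; exact hke i,
      fun i => by rw [h0]; exact hNe i, fun i j => by rw [h0]; exact hee i j⟩, rfl,
    ⟨(0 : Fin (r + 2)), ?_⟩, (1 : Fin (r + 2)), (1 : Fin (r + 2)), (0 : Fin (r + 2)), ?_⟩
  · have hc : ((r + 4 : ℕ) : ℝ) - 2 = r + 2 := by push_cast; ring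
    rw [weyl010i, weylOn_eq]
    simp only [riemannOn_waveMetric_zero hkk hkμ, h0,
      ricciOn_waveMetric_zero hkk hkμ hNN hkN hNμ, ip_minkowski_comm N k,
      ip_minkowski_comm (e 0) k, ip_minkowski_comm (e 0) N, hkk, hkN, hNN, hkμ, hNμ, hee]
    rw [hc]
    have hr : (0 : ℝ) ≤ r := Nat.cast_nonneg r
    refine ne_of_eq_of_ne (b := -((r + 1 : ℝ) / (r + 2))) ?_ (neg_ne_zero.2 (by positivity))
    simp only [if_true, mul_zero, sub_zero, zero_sub, add_zero, zero_add, mul_one]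
    field_simp
    ring
  · have hc : ((r + 4 : ℕ) : ℝ) - 2 = r + 2 := by push_cast; ring
    rw [weyl0ijk, weylOn_eq]
    simp only [riemannOn_waveMetric_zero hkk hkμ, h0,
      ricciOn_waveMetric_zero hkk hkμ hNN hkN hNμ,
      ip_minkowski_comm (e _) k, ip_minkowski_comm (e _) N, hkk, hkN, hke, hNe, hee]
    rw [hc]
    have hr : (0 : ℝ) ≤ r := Nat.cast_nonneg r
    refine ne_of_eq_of_ne (b := 1 / (r + 2 : ℝ)) ?_ (by positivity)
    simp

end KerrSchild

theorem mainTheorem9 (n : ℕ) (hn : 4 ≤ n) :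
    -- extended Kerr–Schild spacetimes with geodetic `k` are of Weyl type I or more special,
    -- and `k` is a WAND
    (∀ (L : ℝ) (U : Set (Coords n)) (g gbar : MetricField n) (H K : Coords n → ℝ)
        (k m : Coords n → Coords n),
      IsExtendedKerrSchild L U g gbar H K k m → IsGeodeticOn U g k →
        IsWeylTypeIOrMoreSpecial U g ∧ ∀ x ∈ U, IsWAND g x (k x)) ∧
    -- in the generalized Kerr–Schild case the boost weight 1 components vanish too
    (∀ (L : ℝ) (U : Set (Coords n)) (g gbar : MetricField n) (H : Coords n → ℝ)
        (k : Coords n → Coords n),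
      IsGeneralizedKerrSchild L U g gbar H k → IsGeodeticOn U g k →
        ∀ x ∈ U, IsMultipleWAND g x (k x)) ∧
    -- in the extended case they need not vanish
    (∃ (L : ℝ) (U : Set (Coords n)) (g gbar : MetricField n) (H K : Coords n → ℝ)
        (k m : Coords n → Coords n),
      IsExtendedKerrSchild L U g gbar H K k m ∧ IsGeodeticOn U g k ∧
        ∃ x ∈ U, ∃ F : NullFrame (g x), F.ell = k x ∧
          (∃ i, weyl010i g x F i ≠ 0) ∧ ∃ i j l, weyl0ijk g x F i j l ≠ 0) := by
  have hn2 : 2 ≤ n := by omega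
  exact ⟨fun L U g gbar H K k m h hgeo => ⟨fun x hx => ⟨k x, h.isWAND hn2 hgeo hx⟩,
      fun x hx => h.isWAND hn2 hgeo hx⟩,
    fun L U g gbar H k h hgeo x hx => h.isMultipleWAND hn2 hgeo hx,
    exists_extendedKerrSchild_not_multipleWAND hn⟩
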